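/- Let $N \ge 2$ and $1 \le N_d \le N$ be integers, let $L_1,\dots,L_N > 0$, let $[a_i,b_i] \subset [0,L_i]$ with $a_i < b_i$ for $1 \le i \le N_d$, let $\chi_i$ be the characteristic function of $[a_i,b_i]$, and let $M = (m_{ij}) \in \mathbb R^{N\times N}$. Consider $$\begin{cases} \partial_t u_i(t,x) + \partial_x u_i(t,x) + \alpha_i(t)\chi_i(x)u_i(t,x) = 0, & t \ge 0,\ x \in [0,L_i],\ 1 \le i \le N_d,\\ \partial_t u_i(t,x) + \partial_x u_i(t,x) = 0, & t \ge 0,\ x \in [0,L_i],\ N_d+1 \le i \le N,\\ u_i(t,0) = \sum_{j=1}^N m_{ij}u_j(t,L_j), & t \ge 0,\ 1 \le i \le N,\\ u_i(0,x) = u_{i,0}(x), & x \in [0,L_i],\ 1 \le i \le N. \end{cases}\tag{1}$$ For $T \ge \mu > 0$, let $\mathcal G(T,\mu)$ be the set of all $\alpha \in L^\infty(\mathbb R,[0,1])$ with $\int_t^{t+T}\alpha(s)\,ds \ge \mu$ for every $t \in \mathbb R$ (the $(T,\mu)$-persistently exciting signals). For $p \in [1,\infty)$, a solution of (1) is a mild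 solution in $\mathsf X_p = \prod_{i=1}^N L^p(0,L_i)$: a continuous function $z = (u_1,\dots,u_N) : [0,\infty) \to \mathsf X_p$ such that, with $z_0 = (u_{1,0},\dots,u_{N,0})$, for every $t \ge 0$ one has $\int_0^t z(\tau)\,d\tau \in D(A)$ and $$z(t) = z_0 + A\int_0^t z(\tau)\,d\tau + \int_0^t \sum_{i=1}^{N_d}\alpha_i(\tau)B_i z(\tau)\,d\tau ,$$ where $A(u_1,\dots,u_N) = (-u_1',\dots,-u_N')$ on $D(A) = \{u \in \prod_i W^{1,p}(0,L_i) : u_i(0) = \sum_j m_{ij}u_j(L_j) \text{ for all } i\}$, and $B_i$ maps $(u_1,\dots,u_N)$ to the vector with $-\chi_i u_i$ in position $i$ and $0$ elsewhere. For $p = \infty$, a solution is a function $z:[0,\infty) \to \prod_i L^\infty(0,L_i)$ that is a mild solution in $\mathsf X_q$ for every $q \in [1,\infty)$. **Theorem.** Suppose that $|M|_{\ell^1} \le 1$, where $|\cdot|_{\ell^1}$ is the matrix norm induced by the $\ell^1$ norm on $\mathbb R^N$, that $m_{ij} \ne 0$ for all $1 \le i,j \le N$, and that there are $1 \le i_*,j_*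 \le N$ with $L_{i_*}/L_{j_*} \notin \mathbb Q$. Then, for every $T \ge \mu > 0$, there exist $C,\gamma > 0$ such that, for every $p \in [1,+\infty]$, every initial condition $u_{i,0} \in L^p(0,L_i)$, $1 \le i \le N$, and every choice of signals $\alpha_i \in \mathcal G(T,\mu)$, $1 \le i \le N_d$, the system (1) has a unique solution, and this solution satisfies $$\sum_{i=1}^N \|u_i(t)\|_{L^p(0,L_i)} \le C e^{-\gamma t}\sum_{i=1}^N \|u_{i,0}\|_{L^p(0,L_i)}, \qquad \forall t \ge 0.$$ -/

import Mathlib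

open MeasureTheory Set
open scoped ENNReal

noncomputable section

/-- The space `∏ᵢ Lᵖ(0, Lᵢ)`. (All the product norms on it, in particular the one in which the
`Lᵖ` norms are combined by an `ℓᵖ` sum, are equivalent.) -/
abbrev NetworkSpace {N : ℕ} (L : Fin N → ℝ) (p : ℝ≥0∞) : Type :=
  ∀ i : Fin N, Lp ℝ p (volume.restrict (Ioo 0 (L i)))

/-- `v` is, on `[0, ℓ]`, the absolutely continuous representative of `U ∈ W^{1,p}(0, ℓ)`, and `W`
is the weak derivative of `U`. (A function `U ∈ Lᵖ(0, ℓ)` belongs to `W^{1,p}(0, ℓ)`, with weak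
derivative `W ∈ Lᵖ(0, ℓ)`, exactly if such a `v` exists.) -/
def IsSobolevRepr {ℓ : ℝ} {p : ℝ≥0∞} (U W : Lp ℝ p (volume.restrict (Ioo 0 ℓ)))
    (v : ℝ → ℝ) : Prop :=
  (∀ x ∈ Icc 0 ℓ, v x = v 0 + ∫ s in (0 : ℝ)..x, W s) ∧
    (∀ᵐ x ∂(volume.restrict (Ioo 0 ℓ)), U x = v x)

/-- `IsTransport L M U F` says that `U ∈ D(A)` and `A U = F`, where `A (u₁, …, u_N) =
(-u₁', …, -u_N')` on the domain `D(A)` of all `(u₁, …, u_N) ∈ ∏ᵢ W^{1,p}(0, Lᵢ)` that satisfy the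
transmission condition `uᵢ(0) = ∑ⱼ mᵢⱼ uⱼ(Lⱼ)` for every `i`. -/
def IsTransport {N : ℕ} (L : Fin N → ℝ) (M : Matrix (Fin N) (Fin N) ℝ) {p : ℝ≥0∞}
    (U F : NetworkSpace L p) : Prop :=
  ∃ v : Fin N → ℝ → ℝ,
    (∀ i, IsSobolevRepr (U i) (-(F i)) (v i)) ∧ ∀ i, v i 0 = ∑ j, M i j * v j (L j)

/-- Multiplication of `u ∈ Lᵖ(0, ℓ)` by the characteristic function of `[a, b]`. -/
def mulCharFun {ℓ : ℝ} {p : ℝ≥0∞} (a b : ℝ) (u : Lp ℝ p (volume.restrict (Ioo 0 ℓ))) :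
    Lp ℝ p (volume.restrict (Ioo 0 ℓ)) :=
  ((Lp.memLp u).indicator (measurableSet_Icc : MeasurableSet (Icc a b))).toLp _

/-- The operator `B_k (u₁, …, u_N) = (0, …, 0, -χ_k u_k, 0, …, 0)`, `1 ≤ k ≤ N_d`, where `χ_k` is
the characteristic function of `[a_k, b_k]`. -/
def dampingOp {N Nd : ℕ} (hNd : Nd ≤ N) (L : Fin N → ℝ) (a b : Fin Nd → ℝ) {p : ℝ≥0∞}
    (k : Fin Nd) (u : NetworkSpace L p) : NetworkSpace L p :=
  Pi.single (Fin.castLE hNd k) (-(mulCharFun (a k) (b k) (u (Fin.castLE hNd k))))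

/-- `z` is a mild solution in `∏ᵢ Lᵖ(0, Lᵢ)` of `z'(t) = A z(t) + ∑ₖ αₖ(t) Bₖ z(t)`, `t ≥ 0`,
`z(0) = z₀`: it is continuous on `[0, ∞)` and, for every `t ≥ 0`, `∫₀ᵗ z(τ) dτ` is in `D(A)` and
`z(t) = z₀ + A ∫₀ᵗ z(τ) dτ + ∫₀ᵗ ∑ₖ αₖ(τ) Bₖ z(τ) dτ`, with Bochner integrals. -/
def IsMildSolution {N Nd : ℕ} (hNd : Nd ≤ N) (L : Fin N → ℝ) (M : Matrix (Fin N) (Fin N) ℝ)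
    (a b : Fin Nd → ℝ) (α : Fin Nd → ℝ → ℝ) (p : ℝ≥0∞) [Fact (1 ≤ p)]
    (z₀ : NetworkSpace L p) (z : ℝ → NetworkSpace L p) : Prop :=
  ContinuousOn z (Ici 0) ∧ z 0 = z₀ ∧
    ∀ t : ℝ, 0 ≤ t →
      IsTransport L M (∫ τ in (0 : ℝ)..t, z τ)
        (z t - z₀ - ∫ τ in (0 : ℝ)..t, ∑ k, α k τ • dampingOp hNd L a b k (z τ))

/-- The inclusion of `∏ᵢ Lᵖ(0, Lᵢ)` in `∏ᵢ L^q(0, Lᵢ)` for `q ≤ p`. -/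
def lowerExponent {N : ℕ} (L : Fin N → ℝ) {p q : ℝ≥0∞} (hqp : q ≤ p) (u : NetworkSpace L p) :
    NetworkSpace L q :=
  fun i => ((Lp.memLp (u i)).mono_exponent hqp).toLp _

/-- `z` is the solution in `∏ᵢ Lᵖ(0, Lᵢ)` of the damped transport system. For `p < ∞` this means a
mild solution. For `p = ∞` it means a function of time with values in `∏ᵢ L^∞(0, Lᵢ)` that is a
mild solution in `∏ᵢ L^q(0, Lᵢ)` for every finite `q ≥ 1`. -/
def IsTransportSolution {N Nd : ℕ} (hNd : Nd ≤ N) (L : Fin N → ℝ)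
    (M : Matrix (Fin N) (Fin N) ℝ) (a b : Fin Nd → ℝ) (α : Fin Nd → ℝ → ℝ) (p : ℝ≥0∞)
    [Fact (1 ≤ p)] (z₀ : NetworkSpace L p) (z : ℝ → NetworkSpace L p) : Prop :=
  (p ≠ ∞ → IsMildSolution hNd L M a b α p z₀ z) ∧
    (p = ∞ → ∀ (q : ℝ≥0∞) [Fact (1 ≤ q)] (hqp : q ≤ p), q ≠ ∞ →
      IsMildSolution hNd L M a b α q (lowerExponent L hqp z₀) (fun t => lowerExponent L hqp (z t)))

/-- The class of `(T, μ)`-persistently exciting signals: `α ∈ L^∞(ℝ, [0, 1])` with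
`∫_t^{t+T} α(s) ds ≥ μ` for every `t ∈ ℝ`. -/
def IsPersistentlyExciting (T μ : ℝ) (α : ℝ → ℝ) : Prop :=
  AEMeasurable α volume ∧ (∀ᵐ s, α s ∈ Icc (0 : ℝ) 1) ∧ ∀ t : ℝ, μ ≤ ∫ s in t..(t + T), α s

/-- The matrix norm induced by the `ℓ¹` norm on `ℝᴺ`. -/
def matrixL1Norm {N : ℕ} (M : Matrix (Fin N) (Fin N) ℝ) : ℝ :=
  ‖LinearMap.toContinuousLinearMap (Matrix.toLpLin 1 1 M)‖

end

/-! The system is solved along characteristics: `u_i(t,x) = v_i(t-x) G_i(t-x,x)`. Here `G_i(s,x)` is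
the attenuation up to `x` of a particle entering edge `i` at time `s`, and the entry trace `v_i` is
`u_i(·,0)` at positive times and the reflected initial datum `f_i` on `(-L_i,0)`. The vertex
condition becomes a delay equation `v = f + V v`. Its Neumann series (`entryTrace`) is locally
finite in time, since each passage costs at least the shortest edge length.

Decay: `V^m f` is a sum over words of `m` edges, but the delay of a word depends only on how often
each edge occurs in it. So at most `(m+1)^N` translates of each `f_j` occur, and their coefficients
are bounded by the mass `survival` that is left after `m` edges (`abs_iterate_vertexStep_le`).
Translation invariance then gives the same constant for every `p`, and it remains to show that the
surviving mass decays geometrically. One damped edge suffices. Persistent excitation makes it damp,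
in every time window of a fixed length, all particles entering during some interval of length `w`.
Irrationality makes the numbers `p L_i + q L_j` `w`-dense on a distant window, so that from any edge
and time a word of bounded length reaches the damped edge during that interval. As no `m_ij`
vanishes, this word carries a fixed share of the mass (`exists_survival_le`), and column sums at
most one exclude a gain elsewhere. At time `t` only iterates with `m` at least about `t/Λ` are
visible, where `Λ` bounds the edge lengths, and the factor `(m+1)^N` is absorbed by a slightly worse
rate.

Existence: Fubini in entry time and position yields a balance law
(`integral_along_characteristics`), which shows that the explicit formula is a mild solution.
Uniqueness: every solution is a mild solution in `L¹`, where `|M| ≤ 1` makes `A` dissipative for the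
sum of the edge norms (`IsTransport.sum_norm_le`); the bounded damping term is handled on short time
steps (`eq_zero_of_dissipative`). -/

noncomputable section

/-! ### Density of integer combinations of two edge lengths -/

/-- The nonnegative integer combinations of two rationally independent positive reals are
`w`-dense on some window of prescribed length, far away. -/
lemma exists_window_nat_combination {x y : ℝ} (hx : 0 < x) (hy : 0 < y)
    (hxy : Irrational (x / y)) (Λ T : ℝ) {w : ℝ} (hw : 0 < w) :
    ∃ (P : ℕ) (R : ℝ), Λ ≤ R ∧ ∀ r ∈ Icc R (R + T), ∃ p q : ℕ, p ≤ P ∧ q ≤ P ∧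
      r ≤ p * x + q * y ∧ p * x + q * y ≤ r + w := by
  have hd := dense_addSubgroupClosure_pair_iff.2 hxy
  obtain ⟨g, hg, hgmem⟩ := hd.exists_mem_open isOpen_Ioo (nonempty_Ioo.2 hw)
  obtain ⟨k, l, hkl⟩ := AddSubgroup.mem_closure_pair.1 hg
  simp only [zsmul_eq_mul] at hkl
  set K : ℕ := ⌈T / g⌉₊ with hK
  -- The group element `g = k x + l y` in `(0, w)` may have a negative coefficient. Starting the
  -- progression of step `g` at `Q (x + y)` keeps both coefficients `Q + n k`, `Q + n l` nonnegative
  -- for the `n ≤ K` needed to sweep a window of length `T`. The second summand of `Q` makes the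
  -- window start beyond `Λ`.
  set Q : ℕ := K * (k.natAbs + l.natAbs) + ⌈Λ / (x + y)⌉₊ with hQ
  refine ⟨Q + K * (k.natAbs + l.natAbs), Q * (x + y), ?_, ?_⟩
  · have h1 : Λ / (x + y) ≤ Q := (Nat.le_ceil _).trans (by rw [hQ]; exact_mod_cast Nat.le_add_left _ _)
    rwa [div_le_iff₀ (by positivity)] at h1
  · intro r hr
    set n : ℕ := ⌈(r - Q * (x + y)) / g⌉₊ with hn
    have hnK : n ≤ K := by
      apply Nat.ceil_le_ceil
      have := hgmem.1
      gcongr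
      linarith [hr.2]
    have hn1 : (r - Q * (x + y)) / g ≤ n := Nat.le_ceil _
    have hn2 : (n : ℝ) < (r - Q * (x + y)) / g + 1 :=
      Nat.ceil_lt_add_one (div_nonneg (by linarith [hr.1]) hgmem.1.le)
    rw [div_le_iff₀ hgmem.1] at hn1
    have hn2' : (n : ℝ) * g < r - Q * (x + y) + g := by
      have := mul_lt_mul_of_pos_right hn2 hgmem.1
      rwa [add_mul, div_mul_cancel₀ _ hgmem.1.ne', one_mul] at this
    have key : ∀ z : ℤ, z.natAbs ≤ k.natAbs + l.natAbs →
        ∃ p : ℕ, p ≤ Q + K * (k.natAbs + l.natAbs) ∧ (p : ℝ) = Q + n * z := by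
      intro z hz
      have hb : n * z.natAbs ≤ K * (k.natAbs + l.natAbs) := Nat.mul_le_mul hnK hz
      have habs : |(n : ℤ) * z| ≤ ((K * (k.natAbs + l.natAbs) : ℕ) : ℤ) := by
        rw [abs_mul, Nat.abs_cast, Int.abs_eq_natAbs]
        exact_mod_cast hb
      have habs' := abs_le.1 habs
      have hQK : ((K * (k.natAbs + l.natAbs) : ℕ) : ℤ) ≤ Q := by
        rw [hQ]; exact_mod_cast Nat.le_add_right _ _
      refine ⟨((Q : ℤ) + n * z).toNat, ?_, ?_⟩
      · zify
        rw [Int.toNat_of_nonneg (by linarith)]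
        push_cast at habs' ⊢
        linarith
      · have h := Int.toNat_of_nonneg (a := (Q : ℤ) + n * z) (by linarith)
        have h2 : (((((Q : ℤ) + n * z).toNat : ℕ) : ℤ) : ℝ) = (((Q : ℤ) + n * z : ℤ) : ℝ) := by
          rw [h]
        push_cast at h2
        simpa using h2
    obtain ⟨p, hp, hp'⟩ := key k (Nat.le_add_right _ _)
    obtain ⟨q, hq, hq'⟩ := key l (Nat.le_add_left _ _)
    have hsum : p * x + q * y = Q * (x + y) + n * g := by
      rw [hp', hq', ← hkl]; ring
    exact ⟨p, q, hp, hq, by rw [hsum]; linarith, by rw [hsum]; linarith [hgmem.2]⟩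

/-! ### Geometric decay of the surviving mass -/

/-- The fraction of a unit mass entering edge `k` at time `s` that is left after `m` edges have
been traversed, if the mass is distributed according to `|M|` at the vertex and if `E i t` is the
damping factor of edge `i` for a particle that enters it at time `t`. -/
def survival {N : ℕ} (L : Fin N → ℝ) (M : Matrix (Fin N) (Fin N) ℝ) (E : Fin N → ℝ → ℝ) :
    ℕ → Fin N → ℝ → ℝ
  | 0, _, _ => 1
  | m + 1, k, s => E k s * ∑ i, |M i k| * survival L M E m i (s + L k)

section Survival

variable {N : ℕ} {L : Fin N → ℝ} {M : Matrix (Fin N) (Fin N) ℝ} {E : Fin N → ℝ → ℝ}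

lemma survival_nonneg (hE0 : ∀ i s, 0 ≤ E i s) (m : ℕ) (k : Fin N) (s : ℝ) :
    0 ≤ survival L M E m k s := by
  induction m generalizing k s with
  | zero => exact zero_le_one
  | succ m ih =>
    exact mul_nonneg (hE0 _ _) (Finset.sum_nonneg fun i _ => mul_nonneg (abs_nonneg _) (ih _ _))

lemma survival_succ_le (hE0 : ∀ i s, 0 ≤ E i s) (hE1 : ∀ i s, E i s ≤ 1)
    (hM : ∀ j, ∑ i, |M i j| ≤ 1) (m : ℕ) (k : Fin N) (s : ℝ) :
    survival L M E (m + 1) k s ≤ survival L M E m k s := by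
  induction m generalizing k s with
  | zero => simpa [survival] using mul_le_one₀ (hE1 k s) (by positivity) (hM k)
  | succ m ih =>
    rw [survival, survival]
    exact mul_le_mul_of_nonneg_left
      (Finset.sum_le_sum fun i _ => mul_le_mul_of_nonneg_left (ih _ _) (abs_nonneg _)) (hE0 _ _)

lemma survival_antitone (hE0 : ∀ i s, 0 ≤ E i s) (hE1 : ∀ i s, E i s ≤ 1)
    (hM : ∀ j, ∑ i, |M i j| ≤ 1) (k : Fin N) (s : ℝ) :
    Antitone fun m => survival L M E m k s :=
  antitone_nat_of_succ_le fun m => survival_succ_le hE0 hE1 hM m k s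

lemma survival_le_one (hE0 : ∀ i s, 0 ≤ E i s) (hE1 : ∀ i s, E i s ≤ 1)
    (hM : ∀ j, ∑ i, |M i j| ≤ 1) (m : ℕ) (k : Fin N) (s : ℝ) :
    survival L M E m k s ≤ 1 :=
  survival_antitone hE0 hE1 hM k s (Nat.zero_le m)

lemma survival_one_le (hE0 : ∀ i s, 0 ≤ E i s) (hM : ∀ j, ∑ i, |M i j| ≤ 1) (k : Fin N) (s : ℝ) :
    survival L M E 1 k s ≤ E k s := by
  simpa [survival] using mul_le_of_le_one_right (hE0 k s) (hM k)

/-- A loss after entering edge `i` is felt, up to a factor, when entering any edge before it. -/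
lemma survival_succ_le_of_le (hE0 : ∀ i s, 0 ≤ E i s) (hE1 : ∀ i s, E i s ≤ 1)
    (hM : ∀ j, ∑ i, |M i j| ≤ 1) {c : ℝ} (hc : ∀ i j, c ≤ |M i j|) {m : ℕ} {i k : Fin N} {s ε : ℝ}
    (hε : 0 ≤ ε) (h : survival L M E m i (s + L k) ≤ 1 - ε) :
    survival L M E (m + 1) k s ≤ 1 - c * ε := by
  have hnn : 0 ≤ ∑ i, |M i k| * survival L M E m i (s + L k) :=
    Finset.sum_nonneg fun i _ => mul_nonneg (abs_nonneg _) (survival_nonneg hE0 _ _ _)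
  calc survival L M E (m + 1) k s
      ≤ ∑ i, |M i k| * survival L M E m i (s + L k) := mul_le_of_le_one_left hnn (hE1 _ _)
    _ ≤ ∑ i', (|M i' k| - if i' = i then c * ε else 0) := by
        refine Finset.sum_le_sum fun i' _ => ?_
        split_ifs with hi
        · subst hi
          nlinarith [mul_le_mul_of_nonneg_left h (abs_nonneg (M i' k)),
            mul_le_mul_of_nonneg_right (hc i' k) hε]
        · simpa using mul_le_of_le_one_right (abs_nonneg (M i' k)) (survival_le_one hE0 hE1 hM _ _ _)
    _ ≤ 1 - c * ε := by
        rw [Finset.sum_sub_distrib, Finset.sum_ite_eq']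
        simpa using hM k

/-- Each of the `p` passages of edge `j` put in front passes on at least the share `c` of the loss.
The starting edge is existential only because it is `i` when `p = 0` and `j` otherwise. -/
lemma survival_add_le_of_repeat (hE0 : ∀ i s, 0 ≤ E i s) (hE1 : ∀ i s, E i s ≤ 1)
    (hM : ∀ j, ∑ i, |M i j| ≤ 1) {c : ℝ} (hc0 : 0 ≤ c) (hc : ∀ i j, c ≤ |M i j|) (j : Fin N)
    {i : Fin N} {m : ℕ} {ε : ℝ} (hε : 0 ≤ ε) (p : ℕ) :
    ∀ s, survival L M E m i (s + p * L j) ≤ 1 - ε →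
      ∃ i', survival L M E (m + p) i' s ≤ 1 - c ^ p * ε := by
  induction p with
  | zero => intro s h; exact ⟨i, by simpa using h⟩
  | succ p ih =>
    intro s h
    obtain ⟨i', hi'⟩ := ih (s + L j) (by convert h using 2; push_cast; ring)
    refine ⟨j, ?_⟩
    have := survival_succ_le_of_le hE0 hE1 hM hc (k := j) (s := s) (by positivity) hi'
    rw [← add_assoc, pow_succ', mul_assoc]
    exact this

/-- If edge `i₀` damps particles entering during some time interval of length `w` in every time
window of length `T`, then the surviving mass is uniformly less than one after a fixed number of
edges. -/
lemma exists_survival_le (hL : ∀ i, 0 < L i) (hM : ∀ j, ∑ i, |M i j| ≤ 1) (hM0 : ∀ i j, M i j ≠ 0)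
    (hirr : ∃ i j, Irrational (L i / L j)) (i₀ : Fin N) (Λ T : ℝ) {w δ : ℝ} (hw : 0 < w)
    (hδ : 0 < δ) :
    ∃ (m₀ : ℕ) (η : ℝ), 0 < m₀ ∧ 0 < η ∧ η < 1 ∧ ∀ E : Fin N → ℝ → ℝ, (∀ i s, 0 ≤ E i s) →
      (∀ i s, E i s ≤ 1) →
      (∀ t, 0 ≤ t → ∃ τ ∈ Icc t (t + T), ∀ s ∈ Icc τ (τ + w), E i₀ s ≤ 1 - δ) →
      ∀ j s, -Λ ≤ s → survival L M E m₀ j s ≤ η := by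
  obtain ⟨i, j, hij⟩ := hirr
  obtain ⟨c, hc0, hc⟩ : ∃ c : ℝ, 0 < c ∧ ∀ i j, c ≤ |M i j| := by
    obtain ⟨x, -, hx⟩ := Finset.exists_min_image (Finset.univ : Finset (Fin N × Fin N))
      (fun x => |M x.1 x.2|) ⟨(i, j), Finset.mem_univ _⟩
    exact ⟨_, abs_pos.2 (hM0 x.1 x.2), fun i j => hx (i, j) (Finset.mem_univ _)⟩
  have hc1 : c ≤ 1 := (hc i i).trans ((Finset.single_le_sum
    (f := fun k => |M k i|) (fun k _ => abs_nonneg _) (Finset.mem_univ i)).trans (hM i))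
  obtain ⟨P, R, hR, hP⟩ := exists_window_nat_combination (hL i) (hL j) hij Λ T hw
  -- The word is: edge `k` once, `p` times edge `i`, `q` times edge `j`, then `i₀`. It has `p + q +
  -- 2` edges and `p + q + 1` transitions, each of weight at least `c`. The maximum with `1 / 2`
  -- only keeps `η` positive.
  refine ⟨P + P + 2, max (1 / 2) (1 - c ^ (P + P + 1) * δ), by omega,
    lt_max_of_lt_left (by norm_num), max_lt (by norm_num) (by linarith [mul_pos (pow_pos hc0 (P + P + 1)) hδ]), ?_⟩
  intro E hE0 hE1 hE k s hs
  refine le_max_of_le_right ?_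
  -- The excitation is only known at nonnegative times; `Λ ≤ R` and `-Λ ≤ s` ensure this.
  obtain ⟨τ, hτ, hEτ⟩ := hE (s + L k + R) (by linarith [hL k])
  obtain ⟨p, q, hp, hq, h1, h2⟩ := hP (τ - s - L k)
    ⟨by linarith [hτ.1], by linarith [hτ.2]⟩
  have h3 : survival L M E 1 i₀ (s + L k + p * L i + q * L j) ≤ 1 - δ :=
    (survival_one_le hE0 hM _ _).trans (hEτ _ ⟨by linarith, by linarith⟩)
  obtain ⟨i₁, h4⟩ := survival_add_le_of_repeat hE0 hE1 hM hc0.le hc j hδ.le q _ h3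
  obtain ⟨i₂, h5⟩ := survival_add_le_of_repeat hE0 hE1 hM hc0.le hc i (by positivity) p _ h4
  have h6 := survival_succ_le_of_le hE0 hE1 hM hc (by positivity) h5
  refine (survival_antitone hE0 hE1 hM k s (by omega : 1 + q + p + 1 ≤ P + P + 2)).trans (h6.trans ?_)
  have h7 : c ^ (P + P + 1) ≤ c ^ (p + q + 1) := pow_le_pow_of_le_one hc0.le hc1 (by omega)
  have h8 : c * (c ^ p * (c ^ q * δ)) = c ^ (p + q + 1) * δ := by ring
  rw [h8]
  nlinarith

/-- The last `m₀` edges of any word cost a factor `η`, whatever precedes them: entry times only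
increase along a word, so the condition `-Λ ≤ s` persists through the induction on the leading
edges. -/
lemma survival_add_le (hE0 : ∀ i s, 0 ≤ E i s) (hL : ∀ i, 0 < L i) {m₀ : ℕ} {η Λ : ℝ}
    (h : ∀ j s, -Λ ≤ s → survival L M E m₀ j s ≤ η) (m : ℕ) :
    ∀ j s, -Λ ≤ s → survival L M E (m + m₀) j s ≤ η * survival L M E m j s := by
  induction m with
  | zero => intro j s hs; simpa [survival] using h j s hs
  | succ m ih =>
    intro j s hs
    rw [Nat.add_right_comm, survival, survival, mul_left_comm, Finset.mul_sum (a := η)]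
    refine mul_le_mul_of_nonneg_left (Finset.sum_le_sum fun i _ => ?_) (hE0 _ _)
    rw [mul_left_comm]
    exact mul_le_mul_of_nonneg_left (ih i _ (by linarith [hL j])) (abs_nonneg _)

/-- Under a persistent excitation condition, the surviving mass decays geometrically. -/
lemma exists_survival_le_geometric (hL : ∀ i, 0 < L i) (hM : ∀ j, ∑ i, |M i j| ≤ 1)
    (hM0 : ∀ i j, M i j ≠ 0) (hirr : ∃ i j, Irrational (L i / L j)) (i₀ : Fin N) (Λ T : ℝ)
    {w δ : ℝ} (hw : 0 < w) (hδ : 0 < δ) :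
    ∃ C η : ℝ, 0 < C ∧ 0 < η ∧ η < 1 ∧ ∀ E : Fin N → ℝ → ℝ, (∀ i s, 0 ≤ E i s) →
      (∀ i s, E i s ≤ 1) →
      (∀ t, 0 ≤ t → ∃ τ ∈ Icc t (t + T), ∀ s ∈ Icc τ (τ + w), E i₀ s ≤ 1 - δ) →
      ∀ m j s, -Λ ≤ s → survival L M E m j s ≤ C * η ^ m := by
  obtain ⟨m₀, η₀, hm₀, hη0, hη1, H⟩ := exists_survival_le hL hM hM0 hirr i₀ Λ T hw hδ
  set η : ℝ := η₀ ^ (1 / (m₀ : ℝ)) with hη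
  have hpos : 0 < η := Real.rpow_pos_of_pos hη0 _
  have hpow : η ^ m₀ = η₀ := by
    rw [hη, one_div, Real.rpow_inv_natCast_pow hη0.le hm₀.ne']
  -- The rate is the `m₀`-th root of the loss over a block of `m₀` edges; the constant covers an
  -- incomplete block, where only the trivial bound by one is available.
  refine ⟨(η ^ m₀)⁻¹, η, by positivity, hpos,
    Real.rpow_lt_one hη0.le hη1 (by positivity), ?_⟩
  intro E hE0 hE1 hE m
  have hlt : η < 1 := Real.rpow_lt_one hη0.le hη1 (by positivity)
  induction m using Nat.strong_induction_on with
  | _ m ih =>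
    intro j s hs
    rw [inv_mul_eq_div, le_div_iff₀ (by positivity)]
    rcases lt_or_ge m m₀ with h | h
    · calc survival L M E m j s * η ^ m₀ ≤ 1 * η ^ m₀ := by
            gcongr; exact survival_le_one hE0 hE1 hM _ _ _
        _ ≤ η ^ m := by rw [one_mul]; exact pow_le_pow_of_le_one hpos.le hlt.le h.le
    · obtain ⟨n, rfl⟩ := Nat.exists_eq_add_of_le' h
      have h1 := survival_add_le hE0 hL (H E hE0 hE1 hE) n j s hs
      have h2 := ih n (by omega) j s hs
      rw [inv_mul_eq_div, le_div_iff₀ (by positivity)] at h2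
      rw [pow_add]
      refine mul_le_mul_of_nonneg_right (h1.trans ?_) (by positivity)
      rw [← hpow, mul_comm]
      exact h2

end Survival

/-! ### Auxiliary estimates in one real variable -/

/-- A persistently exciting signal has, in every time window, a short subinterval on which its
integral is bounded below. -/
lemma exists_short_interval_integral_ge {T μ w : ℝ} (hw : 0 < w) (hT : 0 < T) {β : ℝ → ℝ}
    (hβ : LocallyIntegrable β) (hβ0 : ∀ s, 0 ≤ β s) {t : ℝ}
    (h : μ ≤ ∫ s in t..(t + T), β s) :
    ∃ σ ∈ Icc t (t + T + w), μ / ⌈T / w⌉₊ ≤ ∫ s in σ..(σ + w), β s := by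
  have hint : ∀ x y, IntervalIntegrable β volume x y := fun x y =>
    (hβ.integrableOn_isCompact isCompact_uIcc).intervalIntegrable
  set K := ⌈T / w⌉₊ with hK
  have hKpos : 0 < K := Nat.ceil_pos.2 (by positivity)
  -- Pigeonhole over `K` adjacent intervals of length `w` starting at `t`. They cover `[t, t + T]`;
  -- the possible overshoot is harmless because `β ≥ 0`.
  by_contra! hcon
  have hsum := intervalIntegral.sum_integral_adjacent_intervals (f := β) (μ := volume)
    (a := fun k : ℕ => t + k * w) (n := K) (fun k _ => hint _ _)
  have hKT : T ≤ K * w := by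
    have := Nat.le_ceil (T / w)
    rwa [div_le_iff₀ hw] at this
  have hKT' : K * w < T + w := by
    have := Nat.ceil_lt_add_one (show 0 ≤ T / w by positivity)
    have := mul_lt_mul_of_pos_right this hw
    rwa [add_mul, div_mul_cancel₀ _ hw.ne', one_mul] at this
  have hlt : ∑ k ∈ Finset.range K, ∫ s in (t + k * w)..(t + (k + 1 : ℕ) * w), β s
      < ∑ k ∈ Finset.range K, μ / K := by
    refine Finset.sum_lt_sum_of_nonempty (Finset.nonempty_range_iff.2 hKpos.ne') fun k hk => ?_
    have hk' : (k : ℝ) ≤ K := by exact_mod_cast (Finset.mem_range.1 hk).le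
    have := hcon (t + k * w) ⟨by linarith [mul_nonneg (Nat.cast_nonneg (α := ℝ) k) hw.le],
      by nlinarith⟩
    convert this using 2
    push_cast; ring
  rw [hsum] at hlt
  have hK0 : (K : ℝ) ≠ 0 := by exact_mod_cast hKpos.ne'
  simp only [Finset.sum_const, Finset.card_range, nsmul_eq_mul, Nat.cast_zero, zero_mul,
    add_zero, mul_div_cancel₀ _ hK0] at hlt
  have hadd := intervalIntegral.integral_add_adjacent_intervals (hint t (t + T))
    (hint (t + T) (t + K * w))
  have hnn : 0 ≤ ∫ s in (t + T)..(t + K * w), β s :=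
    intervalIntegral.integral_nonneg (by linarith) fun s _ => hβ0 s
  linarith

/-- The `j`-th column is the image of the `j`-th basis vector, which has `ℓ¹` norm one. -/
lemma sum_abs_le_matrixL1Norm {N : ℕ} (M : Matrix (Fin N) (Fin N) ℝ) (j : Fin N) :
    ∑ i, |M i j| ≤ matrixL1Norm M := by
  have h := (LinearMap.toContinuousLinearMap (Matrix.toLpLin 1 1 M)).le_opNorm
    (WithLp.toLp 1 (Pi.single j (1 : ℝ)))
  simpa [PiLp.norm_eq_of_L1, matrixL1Norm, Matrix.toLpLin_toLp, Pi.single_apply, apply_ite abs] using h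

/-- A continuous function whose upper right increments are at most `κ` per unit length grows at
most with rate `κ`. -/
lemma sub_le_of_eventually_increment_le {Φ : ℝ → ℝ} {a b κ : ℝ} (hab : a ≤ b)
    (hΦ : ContinuousOn Φ (Icc a b))
    (h : ∀ x ∈ Ico a b, ∀ ε > 0, ∀ᶠ y in nhdsWithin x (Ioi x), Φ y - Φ x ≤ (κ + ε) * (y - x)) :
    Φ b - Φ a ≤ κ * (b - a) := by
  have key := image_le_of_liminf_slope_right_le_deriv_boundary (f := Φ) (a := a) (b := b)
    (B := fun x => Φ a + κ * (x - a)) (B' := fun _ => κ) hΦ (by simp) (by fun_prop)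
    (fun x _ => by
      have : HasDerivAt (fun x => Φ a + κ * (x - a)) (κ * 1) x :=
        (((hasDerivAt_id x).sub_const a).const_mul κ).const_add (Φ a)
      simpa using this.hasDerivWithinAt)
    (fun x hx r hr => by
      have hε : 0 < (r - κ) / 2 := by linarith
      have h1 := h x hx _ hε
      refine (Filter.Eventually.frequently ?_)
      filter_upwards [h1, self_mem_nhdsWithin] with y hy hxy
      have hpos : 0 < y - x := sub_pos.2 hxy
      rw [slope_def_field, div_lt_iff₀ hpos]
      nlinarith)
    (right_mem_Icc.2 hab)
  linarith

lemma abs_exp_neg_sub_exp_neg_le {A B : ℝ} (hA : 0 ≤ A) (hB : 0 ≤ B) :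
    |Real.exp (-A) - Real.exp (-B)| ≤ |A - B| := by
  have key : ∀ A B : ℝ, 0 ≤ A → A ≤ B → Real.exp (-A) - Real.exp (-B) ≤ B - A := by
    intro A B hA hAB
    have e1 : Real.exp (-B) = Real.exp (-A) * Real.exp (-(B - A)) := by
      rw [← Real.exp_add]; ring_nf
    have e2 := Real.add_one_le_exp (-(B - A))
    have e3 : Real.exp (-A) ≤ 1 := Real.exp_le_one_iff.2 (by linarith)
    have e4 := Real.exp_pos (-A)
    rw [e1]
    nlinarith
  rcases le_total A B with h | h
  · rw [abs_of_nonneg (sub_nonneg.2 (Real.exp_le_exp.2 (by linarith))),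
      abs_sub_comm, abs_of_nonneg (sub_nonneg.2 h)]
    exact key _ _ hA h
  · rw [abs_sub_comm, abs_of_nonneg (sub_nonneg.2 (Real.exp_le_exp.2 (by linarith))),
      abs_of_nonneg (sub_nonneg.2 h)]
    exact key _ _ hB h

/-- As `k` is merely measurable and bounded, its primitive is Lipschitz but need not be
differentiable everywhere. The exponential is still Lipschitz on `[x, y]`, hence absolutely
continuous, and the fundamental theorem applies with the derivative known almost everywhere. -/
lemma exp_neg_integral_sub {k : ℝ → ℝ} (hk : Measurable k) (h0 : ∀ y, 0 ≤ k y)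
    (h1 : ∀ y, k y ≤ 1) {x y : ℝ} (hx : 0 ≤ x) (hxy : x ≤ y) :
    Real.exp (-∫ r in (0 : ℝ)..y, k r) - Real.exp (-∫ r in (0 : ℝ)..x, k r)
      = -∫ r in x..y, k r * Real.exp (-∫ q in (0 : ℝ)..r, k q) := by
  have hloc : LocallyIntegrable k := by
    refine (locallyIntegrable_const (1 : ℝ)).mono hk.aestronglyMeasurable
      (Filter.Eventually.of_forall fun y => ?_)
    rw [Real.norm_eq_abs, abs_of_nonneg (h0 y)]
    simpa using h1 y
  have hint : ∀ x y, IntervalIntegrable k volume x y := fun x y =>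
    (hloc.integrableOn_isCompact isCompact_uIcc).intervalIntegrable
  set K : ℝ → ℝ := fun x => ∫ r in (0 : ℝ)..x, k r with hK
  have hKsub : ∀ x y, K y - K x = ∫ r in x..y, k r := fun x y =>
    intervalIntegral.integral_interval_sub_left (hint _ _) (hint _ _)
  have hKlip : LipschitzWith 1 K := LipschitzWith.of_dist_le_mul fun x y => by
    have := intervalIntegral.norm_integral_le_of_norm_le_const (f := k) (a := y) (b := x) (C := 1)
      fun r _ => by rw [Real.norm_eq_abs, abs_of_nonneg (h0 r)]; exact h1 r
    simpa [Real.dist_eq, hKsub] using this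
  have hK0 : ∀ z, 0 ≤ z → 0 ≤ K z := fun z hz =>
    intervalIntegral.integral_nonneg hz fun r _ => h0 r
  have hG : LipschitzOnWith 1 (fun z => Real.exp (-K z)) (uIcc x y) := by
    refine LipschitzOnWith.of_dist_le_mul fun z hz z' hz' => ?_
    rw [uIcc_of_le hxy] at hz hz'
    have hd := hKlip.dist_le_mul z z'
    rw [NNReal.coe_one, one_mul] at hd ⊢
    refine le_trans ?_ hd
    rw [Real.dist_eq, Real.dist_eq]
    exact abs_exp_neg_sub_exp_neg_le (hK0 z (hx.trans hz.1)) (hK0 z' (hx.trans hz'.1))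
  have hFTC := hG.absolutelyContinuousOnInterval.integral_deriv_eq_sub
  rw [← hFTC, ← intervalIntegral.integral_neg]
  refine intervalIntegral.integral_congr_ae ?_
  filter_upwards [_root_.LocallyIntegrable.ae_hasDerivAt_integral hloc] with z hz _
  have hd : HasDerivAt (fun z => Real.exp (-K z)) (Real.exp (-K z) * -k z) z := ((hz 0).neg).exp
  rw [hd.deriv]
  ring

/-! ### Attenuation along a characteristic -/

section Attenuation

/-- The total damping coefficient seen between the positions `0` and `x` by a particle that enters
the edge at time `s`, when the damping `β` acts on `[a, b]`. -/
def dampingExponent (β : ℝ → ℝ) (a b s x : ℝ) : ℝ :=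
  ∫ r in (s + a)..(s + max a (min x b)), β r

/-- The damping factor between the positions `0` and `x` for a particle that enters at time `s`. -/
def attenuation (β : ℝ → ℝ) (a b s x : ℝ) : ℝ := Real.exp (-dampingExponent β a b s x)

variable {β : ℝ → ℝ} {a b : ℝ}

lemma locallyIntegrable_of_mem_Icc (hβ : Measurable β) (hβ01 : ∀ s, β s ∈ Icc (0 : ℝ) 1) :
    LocallyIntegrable β := by
  refine (locallyIntegrable_const (1 : ℝ)).mono hβ.aestronglyMeasurable
    (Filter.Eventually.of_forall fun y => ?_)
  rw [Real.norm_eq_abs, abs_of_nonneg (hβ01 y).1]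
  simpa using (hβ01 y).2

lemma intervalIntegrable_of_mem_Icc (hβ : Measurable β) (hβ01 : ∀ s, β s ∈ Icc (0 : ℝ) 1)
    (x y : ℝ) : IntervalIntegrable β volume x y :=
  ((locallyIntegrable_of_mem_Icc hβ hβ01).integrableOn_isCompact isCompact_uIcc).intervalIntegrable

lemma abs_integral_le_of_mem_Icc (hβ01 : ∀ s, β s ∈ Icc (0 : ℝ) 1) (x y : ℝ) :
    |∫ r in x..y, β r| ≤ |y - x| := by
  simpa using intervalIntegral.norm_integral_le_of_norm_le_const (f := β) (a := x) (b := y) (C := 1)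
    fun r _ => by rw [Real.norm_eq_abs, abs_of_nonneg (hβ01 r).1]; exact (hβ01 r).2

lemma dampingExponent_nonneg (hβ01 : ∀ s, β s ∈ Icc (0 : ℝ) 1) (s x : ℝ) :
    0 ≤ dampingExponent β a b s x :=
  intervalIntegral.integral_nonneg (by gcongr; exact le_max_left _ _) fun r _ => (hβ01 r).1

lemma attenuation_pos (s x : ℝ) : 0 < attenuation β a b s x := Real.exp_pos _

lemma attenuation_le_one (hβ01 : ∀ s, β s ∈ Icc (0 : ℝ) 1) (s x : ℝ) :
    attenuation β a b s x ≤ 1 :=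
  Real.exp_le_one_iff.2 (neg_nonpos.2 (dampingExponent_nonneg hβ01 s x))

lemma continuous_attenuation (hβ : Measurable β) (hβ01 : ∀ s, β s ∈ Icc (0 : ℝ) 1) :
    Continuous fun z : ℝ × ℝ => attenuation β a b z.1 z.2 := by
  have hB : Continuous fun x => ∫ r in (0 : ℝ)..x, β r :=
    intervalIntegral.continuous_primitive (intervalIntegrable_of_mem_Icc hβ hβ01) 0
  have : ∀ z : ℝ × ℝ, dampingExponent β a b z.1 z.2
      = (∫ r in (0 : ℝ)..(z.1 + max a (min z.2 b)), β r) - ∫ r in (0 : ℝ)..(z.1 + a), β r :=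
    fun z => (intervalIntegral.integral_interval_sub_left
      (intervalIntegrable_of_mem_Icc hβ hβ01 _ _) (intervalIntegrable_of_mem_Icc hβ hβ01 _ _)).symm
  simp only [attenuation, this]
  exact Real.continuous_exp.comp
    ((hB.comp (by fun_prop)).sub (hB.comp (by fun_prop))).neg

/-- Changing the entry time moves both endpoints of the integration interval by `|s - s'|`, which
explains the constant 2. The bound is uniform in `x`, as the continuity of the flow in time
requires. -/
lemma abs_attenuation_sub_le (hβ : Measurable β) (hβ01 : ∀ s, β s ∈ Icc (0 : ℝ) 1) (s s' x : ℝ) :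
    |attenuation β a b s x - attenuation β a b s' x| ≤ 2 * |s - s'| := by
  refine (abs_exp_neg_sub_exp_neg_le (dampingExponent_nonneg hβ01 _ _)
    (dampingExponent_nonneg hβ01 _ _)).trans ?_
  have hI := intervalIntegrable_of_mem_Icc hβ hβ01
  set c := max a (min x b)
  have h : dampingExponent β a b s x - dampingExponent β a b s' x
      = (∫ r in (s + a)..(s' + a), β r) - ∫ r in (s + c)..(s' + c), β r := by
    exact intervalIntegral.integral_interval_sub_interval_comm (hI _ _) (hI _ _) (hI _ _)
  have h1 := abs_integral_le_of_mem_Icc hβ01 (s + a) (s' + a)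
  have h2 := abs_integral_le_of_mem_Icc hβ01 (s + c) (s' + c)
  rw [add_sub_add_right_eq_sub, abs_sub_comm] at h1 h2
  rw [h]
  linarith [abs_sub (∫ r in (s + a)..(s' + a), β r) (∫ r in (s + c)..(s' + c), β r)]

lemma attenuation_zero_right (ha : 0 ≤ a) (hab : a ≤ b) (s : ℝ) : attenuation β a b s 0 = 1 := by
  have : max a (min 0 b) = a := by rw [min_eq_left (ha.trans hab), max_eq_left ha]
  simp [attenuation, dampingExponent, this]

/-- A particle found at position `y` at time zero is given the fictitious entry time `-y`. Since `β`
vanishes before time zero, it arrives there undamped, so the initial datum is recovered exactly. -/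
lemma attenuation_neg_right (hβ0 : ∀ r ≤ 0, β r = 0) (s : ℝ) :
    attenuation β a b s (-s) = 1 := by
  have : dampingExponent β a b s (-s) = 0 := by
    rw [dampingExponent]
    rcases le_or_gt (-s) a with h | h
    · rw [max_eq_left ((min_le_left _ _).trans h), intervalIntegral.integral_same]
    · refine intervalIntegral.integral_zero_ae (Filter.Eventually.of_forall fun r hr => hβ0 r ?_)
      refine hr.2.trans (max_le (by linarith) ?_)
      rcases max_cases a (min (-s) b) with h' | h' <;> rw [h'.1]
      · linarith
      · linarith [min_le_left (-s) b]
  rw [attenuation, this, neg_zero, Real.exp_zero]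

lemma dampingExponent_eq_integral (ha : 0 ≤ a) (s : ℝ) {x : ℝ} (hx : 0 ≤ x) :
    dampingExponent β a b s x
      = ∫ y in (0 : ℝ)..x, (Icc a b).indicator (fun y => β (s + y)) y := by
  rw [dampingExponent, intervalIntegral.integral_of_le hx,
    setIntegral_indicator measurableSet_Icc]
  rw [← intervalIntegral.integral_comp_add_left (fun r => β r) s,
    intervalIntegral.integral_of_le (le_max_left _ _)]
  refine setIntegral_congr_set ?_
  have hs : Ioc a (max a (min x b)) =ᵐ[volume] Icc a (min x b) := by
    rcases le_total a (min x b) with h | h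
    · rw [max_eq_right h]; exact Ioc_ae_eq_Icc
    · rw [max_eq_left h, Ioc_self]
      have h0 : volume ({a} : Set ℝ) = 0 := by simp
      filter_upwards [measure_eq_zero_iff_ae_notMem.1 h0] with y hy
      exact propext ⟨fun h' => absurd h' (notMem_empty y),
        fun h' => absurd (le_antisymm (h'.2.trans h) h'.1) hy⟩
  refine hs.trans ?_
  have hs2 : Icc a (min x b) =ᵐ[volume] (Icc 0 x ∩ Icc a b : Set ℝ) := by
    rw [Icc_inter_Icc, sup_eq_right.2 ha]
    exact Filter.EventuallyEq.rfl
  exact hs2.trans ((Ioc_ae_eq_Icc (μ := volume)).symm.inter Filter.EventuallyEq.rfl)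

/-- This is the damping equation `∂G/∂y = -k G` in integrated form, valid for a signal that is only
measurable. -/
lemma attenuation_sub (hβ : Measurable β) (hβ01 : ∀ s, β s ∈ Icc (0 : ℝ) 1) (ha : 0 ≤ a)
    (s : ℝ) {x y : ℝ} (hx : 0 ≤ x) (hxy : x ≤ y) :
    attenuation β a b s y - attenuation β a b s x
      = -∫ r in x..y, (Icc a b).indicator (fun r => β (s + r)) r * attenuation β a b s r := by
  have hind : ∀ r, (Icc a b).indicator (fun r => β (s + r)) r ∈ Icc (0 : ℝ) 1 := fun r => by
    by_cases h : r ∈ Icc a b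
    · rw [indicator_of_mem h]; exact hβ01 _
    · rw [indicator_of_notMem h]; simp
  have key := exp_neg_integral_sub (k := (Icc a b).indicator fun r => β (s + r))
    ((hβ.comp (measurable_const_add s)).indicator measurableSet_Icc)
    (fun r => (hind r).1) (fun r => (hind r).2) hx hxy
  rw [attenuation, attenuation, dampingExponent_eq_integral ha s hx,
    dampingExponent_eq_integral ha s (hx.trans hxy), key]
  congr 1
  refine intervalIntegral.integral_congr fun r hr => ?_
  rw [uIcc_of_le hxy] at hr
  simp only [attenuation]
  rw [dampingExponent_eq_integral ha s (hx.trans hr.1)]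

end Attenuation

/-! ### Balance law by Fubini along characteristics -/

/-- The balance law on `[0, t] × [0, x]` for `u(τ, y) = v (τ - y) * G (τ - y) y`, where `G s`
solves `∂G/∂y = - k G` along the characteristic that starts at time `s`. -/
lemma integral_along_characteristics {v : ℝ → ℝ} {t x : ℝ} (ht : 0 ≤ t)
    (hx : 0 ≤ x) (hv : IntegrableOn v (Ioc (-x) t)) {k G : ℝ → ℝ → ℝ}
    (hk : Measurable (Function.uncurry k)) (hk1 : ∀ s y, |k s y| ≤ 1)
    (hG : Measurable (Function.uncurry G)) (hG1 : ∀ s y, |G s y| ≤ 1)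
    (hkG : ∀ s y₁ y₂, 0 ≤ y₁ → y₁ ≤ y₂ → G s y₂ - G s y₁ = -∫ y in y₁..y₂, k s y * G s y) :
    (∫ τ in (0 : ℝ)..t, v (τ - x) * G (τ - x) x) + ∫ y in (0 : ℝ)..x, v (t - y) * G (t - y) y
      = (∫ s in (0 : ℝ)..t, v s * G s 0) + (∫ y in (0 : ℝ)..x, v (-y) * G (-y) y)
        - ∫ y in (0 : ℝ)..x, ∫ τ in (0 : ℝ)..t, k (τ - y) y * (v (τ - y) * G (τ - y) y) := by
  have hxt : -x ≤ t := by linarith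
  have hvG : ∀ φ : ℝ → ℝ, Measurable φ →
      IntervalIntegrable (fun s => v s * G s (φ s)) volume (-x) t := by
    intro φ hφ
    rw [intervalIntegrable_iff_integrableOn_Ioc_of_le hxt]
    refine Integrable.mono hv (hv.aestronglyMeasurable.mul
      (hG.comp (measurable_id.prodMk hφ)).aestronglyMeasurable) (Filter.Eventually.of_forall fun s => ?_)
    simpa [abs_mul] using mul_le_of_le_one_right (abs_nonneg (v s)) (hG1 s (φ s))
  have hsub : ∀ {φ : ℝ → ℝ} (_ : Measurable φ) {c d : ℝ}, -x ≤ c → c ≤ d → d ≤ t →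
      IntervalIntegrable (fun s => v s * G s (φ s)) volume c d := fun hφ c d h1 h2 h3 =>
    (hvG _ hφ).mono_set (by
      rw [uIcc_of_le h2, uIcc_of_le hxt]; exact Icc_subset_Icc h1 h3)
  have hmexit : Measurable fun s : ℝ => min x (t - s) := by fun_prop
  have hmenter : Measurable fun s : ℝ => max 0 (-s) := by fun_prop
  -- Characteristics are labelled by `s`, the time at which they cross position zero. The one
  -- labelled `s` leaves the rectangle at position `min x (t - s)`: through the side at `x` if `s ≤
  -- t - x`, at the final time otherwise.
  have hexit : (∫ τ in (0 : ℝ)..t, v (τ - x) * G (τ - x) x)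
      + ∫ y in (0 : ℝ)..x, v (t - y) * G (t - y) y
      = ∫ s in (-x)..t, v s * G s (min x (t - s)) := by
    rw [← intervalIntegral.integral_add_adjacent_intervals
      (hsub hmexit le_rfl (by linarith : -x ≤ t - x) (by linarith))
      (hsub hmexit (by linarith : -x ≤ t - x) (by linarith) le_rfl)]
    congr 1
    · rw [intervalIntegral.integral_comp_sub_right (fun s => v s * G s x) x, zero_sub]
      refine intervalIntegral.integral_congr fun s hs => ?_
      rw [uIcc_of_le (by linarith)] at hs
      rw [min_eq_left (by linarith [hs.2])]
    · have := intervalIntegral.integral_comp_sub_left (a := 0) (b := x)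
        (fun s => v s * G s (t - s)) t
      simp only [sub_sub_cancel, sub_zero] at this
      rw [this]
      refine intervalIntegral.integral_congr fun s hs => ?_
      rw [uIcc_of_le (by linarith)] at hs
      rw [min_eq_right (by linarith [hs.1])]
  -- It enters at position `max 0 (-s)`: through the vertex if `s ≥ 0`, at time zero otherwise.
  have henter : (∫ s in (0 : ℝ)..t, v s * G s 0) + ∫ y in (0 : ℝ)..x, v (-y) * G (-y) y
      = ∫ s in (-x)..t, v s * G s (max 0 (-s)) := by
    rw [← intervalIntegral.integral_add_adjacent_intervals
      (hsub hmenter le_rfl (by linarith : -x ≤ 0) ht)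
      (hsub hmenter (by linarith : -x ≤ 0) ht le_rfl), add_comm]
    congr 1
    · have := intervalIntegral.integral_comp_neg (a := 0) (b := x) (fun s => v s * G s (-s))
      simp only [neg_neg, neg_zero] at this
      rw [this]
      refine intervalIntegral.integral_congr fun s hs => ?_
      rw [uIcc_of_le (by linarith)] at hs
      rw [max_eq_right (by linarith [hs.2])]
    · refine intervalIntegral.integral_congr fun s hs => ?_
      rw [uIcc_of_le ht] at hs
      rw [max_eq_left (by linarith [hs.1])]
  have hkGm : Measurable (Function.uncurry fun s y => k s y * G s y) := hk.mul hG
  have hkG1 : ∀ s y, |k s y * G s y| ≤ 1 := fun s y => by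
    rw [abs_mul]; exact mul_le_one₀ (hk1 s y) (abs_nonneg _) (hG1 s y)
  -- This is the loss density in the coordinates `(s, y)`, set to zero outside the time interval.
  -- Integrating first in `y` gives the entering minus the leaving mass by `hkG`; integrating first
  -- in `s` gives the double integral of the claim.
  set h : ℝ → ℝ → ℝ := fun s y => (Ioc (-s) (t - s)).indicator (fun y => v s * (k s y * G s y)) y
    with hdef
  have hset : MeasurableSet {z : ℝ × ℝ | z.2 ∈ Ioc (-z.1) (t - z.1)} :=
    (measurableSet_lt (f := fun z : ℝ × ℝ => -z.1) (g := fun z => z.2) (by fun_prop)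
      (by fun_prop)).inter (measurableSet_le (f := fun z : ℝ × ℝ => z.2)
      (g := fun z => t - z.1) (by fun_prop) (by fun_prop))
  have hint : Integrable (Function.uncurry h)
      ((volume.restrict (Ioc (-x) t)).prod (volume.restrict (Ioc 0 x))) := by
    have h1 : Integrable (fun z : ℝ × ℝ => v z.1)
        ((volume.restrict (Ioc (-x) t)).prod (volume.restrict (Ioc 0 x))) :=
      Integrable.comp_fst (μ := volume.restrict (Ioc (-x) t)) hv _
    have h2 : Function.uncurry h = {z : ℝ × ℝ | z.2 ∈ Ioc (-z.1) (t - z.1)}.indicator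
        (fun z => v z.1 * (k z.1 z.2 * G z.1 z.2)) := rfl
    rw [h2]
    refine Integrable.indicator ?_ hset
    refine h1.mono (h1.aestronglyMeasurable.mul hkGm.aestronglyMeasurable)
      (Filter.Eventually.of_forall fun z => ?_)
    simpa only [norm_mul, Real.norm_eq_abs, abs_mul] using
      mul_le_of_le_one_right (abs_nonneg (v z.1)) (by simpa [abs_mul] using hkG1 z.1 z.2)
  have hswap := integral_integral_swap hint
  have hleft : ∫ s in Ioc (-x) t, (∫ y in Ioc 0 x, h s y)
      = ∫ s in Ioc (-x) t, -(v s * G s (min x (t - s)) - v s * G s (max 0 (-s))) := by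
    refine setIntegral_congr_fun measurableSet_Ioc fun s hs => ?_
    simp only [hdef]
    rw [setIntegral_indicator measurableSet_Ioc, Ioc_inter_Ioc, integral_const_mul,
      ← intervalIntegral.integral_of_le (
        max_le (le_min hx (by linarith [hs.2])) (le_min (by linarith [hs.1]) (by linarith)))]
    have := hkG s (max 0 (-s)) (min x (t - s)) (le_max_left _ _) (
        max_le (le_min hx (by linarith [hs.2])) (le_min (by linarith [hs.1]) (by linarith)))
    rw [← mul_sub, this]
    ring
  have hright : ∫ y in Ioc 0 x, (∫ s in Ioc (-x) t, h s y)
      = ∫ y in Ioc 0 x, ∫ τ in (0 : ℝ)..t, k (τ - y) y * (v (τ - y) * G (τ - y) y) := by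
    refine setIntegral_congr_fun measurableSet_Ioc fun y hy => ?_
    have h1 : (fun s => h s y)
        = (Ioc (-y) (t - y)).indicator fun s => k s y * (v s * G s y) := by
      funext s
      simp only [hdef, indicator, mem_Ioc]
      split_ifs with c1 c2 c2
      · ring
      · exact absurd ⟨by linarith [c1.1], by linarith [c1.2]⟩ c2
      · exact absurd ⟨by linarith [c2.1], by linarith [c2.2]⟩ c1
      · rfl
    rw [h1, setIntegral_indicator measurableSet_Ioc, inter_eq_right.2
      (Ioc_subset_Ioc (by linarith [hy.2]) (by linarith [hy.1])),
      intervalIntegral.integral_comp_sub_right (fun s => k s y * (v s * G s y)) y, zero_sub,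
      intervalIntegral.integral_of_le (by linarith)]
  rw [hexit, henter, intervalIntegral.integral_of_le hx, ← hright, ← hswap, hleft,
    ← intervalIntegral.integral_of_le hxt, intervalIntegral.integral_neg,
    intervalIntegral.integral_sub (hvG _ hmexit) (hvG _ hmenter)]
  ring

/-! ### Bochner integrals and changes of exponent in Lebesgue spaces -/

section LpTools

variable {X : Type*} [MeasurableSpace X] {μ : Measure X}

/-- The inclusion of `Lᵖ` in `L^q` for `q ≤ p` and a finite measure. -/
def lowerExponentLp [IsFiniteMeasure μ] {p q : ℝ≥0∞} [Fact (1 ≤ p)] [Fact (1 ≤ q)] (hqp : q ≤ p) :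
    Lp ℝ p μ →L[ℝ] Lp ℝ q μ :=
  LinearMap.mkContinuous
    { toFun := fun u => ((Lp.memLp u).mono_exponent hqp).toLp _
      map_add' := fun u v => by
        rw [← MemLp.toLp_add]
        exact MemLp.toLp_congr _ _ (Lp.coeFn_add u v)
      map_smul' := fun c u => by
        rw [RingHom.id_apply, ← MemLp.toLp_const_smul]
        exact MemLp.toLp_congr _ _ (Lp.coeFn_smul c u) }
    (μ univ ^ (1 / q.toReal - 1 / p.toReal)).toReal
    (fun u => by
      have hq : q ≠ 0 := fun h => by simpa [h] using (Fact.out : 1 ≤ q)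
      have hexp : 0 ≤ 1 / q.toReal - 1 / p.toReal := by
        -- For `p = ∞` the conventions `toReal ∞ = 0` and `1 / 0 = 0` give the correct Hölder
        -- exponent.
        rcases eq_or_ne p ∞ with rfl | hp
        · simp
        · have : 0 < q.toReal := ENNReal.toReal_pos hq (ne_top_of_le_ne_top hp hqp)
          exact sub_nonneg.2 (one_div_le_one_div_of_le this (ENNReal.toReal_mono hp hqp))
      change ‖((Lp.memLp u).mono_exponent hqp).toLp _‖ ≤ _
      rw [Lp.norm_toLp, Lp.norm_def, mul_comm, ← ENNReal.toReal_mul]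
      exact ENNReal.toReal_mono (ENNReal.mul_ne_top (Lp.eLpNorm_ne_top u)
        (ENNReal.rpow_ne_top_of_nonneg hexp (measure_ne_top μ _)))
        (eLpNorm_le_eLpNorm_mul_rpow_measure_univ hqp (Lp.aestronglyMeasurable u)))

lemma coeFn_lowerExponentLp [IsFiniteMeasure μ] {p q : ℝ≥0∞} [Fact (1 ≤ p)] [Fact (1 ≤ q)]
    (hqp : q ≤ p) (u : Lp ℝ p μ) : lowerExponentLp hqp u =ᵐ[μ] u :=
  MemLp.coeFn_toLp ((Lp.memLp u).mono_exponent hqp)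

/-- Integration over a set as a continuous functional on `L¹`. -/
def setIntegralL1 (A : Set X) : Lp ℝ 1 μ →L[ℝ] ℝ :=
  LinearMap.mkContinuous
    { toFun := fun u => ∫ x in A, u x ∂μ
      map_add' := fun u v => by
        rw [← integral_add (L1.integrable_coeFn u).integrableOn
          (L1.integrable_coeFn v).integrableOn]
        exact integral_congr_ae (ae_restrict_of_ae (Lp.coeFn_add u v))
      map_smul' := fun c u => by
        rw [RingHom.id_apply, ← integral_smul]
        exact integral_congr_ae (ae_restrict_of_ae (Lp.coeFn_smul c u)) }
    1
    (fun u => by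
      rw [one_mul, L1.norm_eq_integral_norm]
      exact (norm_integral_le_integral_norm _).trans (setIntegral_le_integral
        (L1.integrable_coeFn u).norm (Filter.Eventually.of_forall fun x => norm_nonneg _)))

lemma setIntegralL1_apply (A : Set X) (u : Lp ℝ 1 μ) :
    setIntegralL1 A u = ∫ x in A, u x ∂μ := rfl

/-- The Bochner integral of an `Lᵖ`-valued function is the pointwise integral. -/
lemma coeFn_integral_Lp [IsFiniteMeasure μ] {Y : Type*} [MeasurableSpace Y] {ν : Measure Y}
    [SFinite ν] {p : ℝ≥0∞} [Fact (1 ≤ p)] {Z : Y → Lp ℝ p μ} (hZ : Integrable Z ν)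
    {g : Y → X → ℝ} (hg : Measurable (Function.uncurry g)) (h : ∀ᵐ τ ∂ν, Z τ =ᵐ[μ] g τ) :
    (∫ τ, Z τ ∂ν : Lp ℝ p μ) =ᵐ[μ] fun x => ∫ τ, g τ x ∂ν := by
  set J : Lp ℝ p μ →L[ℝ] Lp ℝ 1 μ := lowerExponentLp Fact.out
  have hJZ : Integrable (fun τ => J (Z τ)) ν := J.integrable_comp hZ
  have hJg : ∀ᵐ τ ∂ν, J (Z τ) =ᵐ[μ] g τ := by
    filter_upwards [h] with τ hτ using (coeFn_lowerExponentLp _ _).trans hτ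
  have hgint : Integrable (Function.uncurry g) (ν.prod μ) := by
    rw [integrable_prod_iff hg.aestronglyMeasurable]
    refine ⟨?_, hJZ.norm.congr ?_⟩
    · filter_upwards [hJg] with τ hτ using (L1.integrable_coeFn _).congr hτ
    · filter_upwards [hJg] with τ hτ
      rw [L1.norm_eq_integral_norm]
      exact integral_congr_ae (hτ.fun_comp _)
  refine (coeFn_lowerExponentLp (Fact.out : 1 ≤ p) _).symm.trans ?_
  change (J (∫ τ, Z τ ∂ν)) =ᵐ[μ] _
  rw [← J.integral_comp_comm hZ]
  -- Two functions in `L¹` agree if their integrals over all measurable sets do. These integrals are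
  -- continuous functionals, so they commute with the Bochner integral, and Fubini finishes the
  -- comparison.
  refine Integrable.ae_eq_of_forall_setIntegral_eq _ _ (L1.integrable_coeFn _)
    hgint.integral_prod_right fun A hA _ => ?_
  rw [← setIntegralL1_apply, ← (setIntegralL1 A).integral_comp_comm hJZ,
    integral_integral_swap (f := fun x τ => g τ x)]
  · refine integral_congr_ae ?_
    filter_upwards [hJg] with τ hτ
    exact integral_congr_ae (ae_restrict_of_ae hτ)
  · have : Integrable (Function.uncurry g) (ν.prod (μ.restrict A)) :=
      hgint.mono_measure (Measure.prod_mono le_rfl Measure.restrict_le_self)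
    exact this.swap

lemma coeFn_intervalIntegral_Lp [IsFiniteMeasure μ] {p : ℝ≥0∞} [Fact (1 ≤ p)] {t : ℝ} (ht : 0 ≤ t)
    {Z : ℝ → Lp ℝ p μ} (hZ : IntervalIntegrable Z volume 0 t)
    {g : ℝ → X → ℝ} (hg : Measurable (Function.uncurry g))
    (h : ∀ᵐ τ ∂(volume.restrict (Ioc 0 t)), Z τ =ᵐ[μ] g τ) :
    (∫ τ in (0 : ℝ)..t, Z τ : Lp ℝ p μ) =ᵐ[μ] fun x => ∫ τ in (0 : ℝ)..t, g τ x := by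
  simp only [intervalIntegral.integral_of_le ht]
  exact coeFn_integral_Lp ((intervalIntegrable_iff_integrableOn_Ioc_of_le ht).1 hZ) hg h

end LpTools

/-! ### The operators of the system as continuous linear maps -/

section Network

variable {N Nd : ℕ} (L : Fin N → ℝ)

/-- `lowerExponent` as a continuous linear map. -/
def lowerExponentCLM {p q : ℝ≥0∞} [Fact (1 ≤ p)] [Fact (1 ≤ q)] (hqp : q ≤ p) :
    NetworkSpace L p →L[ℝ] NetworkSpace L q :=
  ContinuousLinearMap.pi fun i => (lowerExponentLp hqp).comp (ContinuousLinearMap.proj i)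

lemma lowerExponentCLM_apply {p q : ℝ≥0∞} [Fact (1 ≤ p)] [Fact (1 ≤ q)] (hqp : q ≤ p)
    (u : NetworkSpace L p) : lowerExponentCLM L hqp u = lowerExponent L hqp u := rfl

/-- Uniqueness in `L¹` passes through this injection to every exponent. -/
lemma lowerExponent_injective {p q : ℝ≥0∞} (hqp : q ≤ p) :
    Function.Injective (lowerExponent L hqp) := fun u v huv => by
  funext i
  refine Lp.ext ?_
  have hi := congr_fun huv i
  exact (MemLp.coeFn_toLp _).symm.trans ((Lp.ext_iff.1 hi).trans (MemLp.coeFn_toLp _))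

variable {L}

lemma coeFn_mulCharFun {ℓ : ℝ} {p : ℝ≥0∞} (a b : ℝ) (u : Lp ℝ p (volume.restrict (Ioo 0 ℓ))) :
    mulCharFun a b u =ᵐ[volume.restrict (Ioo 0 ℓ)] (Icc a b).indicator u :=
  MemLp.coeFn_toLp _

lemma norm_mulCharFun_le {ℓ : ℝ} {p : ℝ≥0∞} (a b : ℝ)
    (u : Lp ℝ p (volume.restrict (Ioo 0 ℓ))) : ‖mulCharFun a b u‖ ≤ ‖u‖ := by
  rw [mulCharFun, Lp.norm_toLp, Lp.norm_def]
  exact ENNReal.toReal_mono (Lp.eLpNorm_ne_top u) (eLpNorm_indicator_le _)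

/-- `mulCharFun` as a continuous linear map. -/
def mulCharFunCLM {ℓ : ℝ} {p : ℝ≥0∞} [Fact (1 ≤ p)] (a b : ℝ) :
    Lp ℝ p (volume.restrict (Ioo 0 ℓ)) →L[ℝ] Lp ℝ p (volume.restrict (Ioo 0 ℓ)) :=
  LinearMap.mkContinuous
    { toFun := mulCharFun a b
      map_add' := fun u v => by
        refine Lp.ext ?_
        filter_upwards [coeFn_mulCharFun a b (u + v), coeFn_mulCharFun a b u, coeFn_mulCharFun a b v,
          Lp.coeFn_add u v, Lp.coeFn_add (mulCharFun a b u) (mulCharFun a b v)] with x h1 h2 h3 h4 h5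
        rw [h1, h5, Pi.add_apply, h2, h3]
        by_cases hx : x ∈ Icc a b
        · simp only [indicator_of_mem hx]; exact h4
        · simp only [indicator_of_notMem hx, add_zero]
      map_smul' := fun c u => by
        refine Lp.ext ?_
        filter_upwards [coeFn_mulCharFun a b (c • u), coeFn_mulCharFun a b u,
          Lp.coeFn_smul c u, Lp.coeFn_smul c (mulCharFun a b u)] with x h1 h2 h3 h4
        rw [h1, RingHom.id_apply, h4, Pi.smul_apply, h2]
        by_cases hx : x ∈ Icc a b <;> simp [hx, h3] }
    1 (fun u => by rw [one_mul]; exact norm_mulCharFun_le a b u)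

/-- `dampingOp` as a continuous linear map. -/
def dampingCLM (hNd : Nd ≤ N) (L : Fin N → ℝ) (a b : Fin Nd → ℝ) {p : ℝ≥0∞} [Fact (1 ≤ p)]
    (k : Fin Nd) : NetworkSpace L p →L[ℝ] NetworkSpace L p :=
  (ContinuousLinearMap.single ℝ (fun i => Lp ℝ p (volume.restrict (Ioo 0 (L i))))
    (Fin.castLE hNd k)).comp
    (-((mulCharFunCLM (a k) (b k)).comp (ContinuousLinearMap.proj (Fin.castLE hNd k))))

lemma dampingCLM_apply (hNd : Nd ≤ N) (L : Fin N → ℝ) (a b : Fin Nd → ℝ) {p : ℝ≥0∞} [Fact (1 ≤ p)]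
    (k : Fin Nd) (u : NetworkSpace L p) :
    dampingCLM hNd L a b k u = dampingOp hNd L a b k u := rfl

lemma intervalIntegrable_damping (hNd : Nd ≤ N) (L : Fin N → ℝ) (a b : Fin Nd → ℝ)
    {p : ℝ≥0∞} [Fact (1 ≤ p)] {α : Fin Nd → ℝ → ℝ} (hα : ∀ k, AEMeasurable (α k))
    (hα1 : ∀ k, ∀ᵐ s, α k s ∈ Icc (0 : ℝ) 1) {z : ℝ → NetworkSpace L p}
    (hz : ContinuousOn z (Ici 0)) {s t : ℝ} (hs : 0 ≤ s) (ht : 0 ≤ t) :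
    IntervalIntegrable (fun τ => ∑ k, α k τ • dampingOp hNd L a b k (z τ)) volume s t := by
  have hsub : uIcc s t ⊆ Ici 0 := fun r hr => (le_min hs ht).trans hr.1
  suffices h : ∀ k, IntervalIntegrable (fun τ => α k τ • dampingOp hNd L a b k (z τ)) volume s t by
    have h' := IntervalIntegrable.sum Finset.univ fun k _ => h k
    rwa [show (∑ k, fun τ => α k τ • dampingOp hNd L a b k (z τ))
      = fun τ => ∑ k, α k τ • dampingOp hNd L a b k (z τ) by funext τ; simp] at h'
  intro k
  have hc : ContinuousOn (fun τ => dampingCLM hNd L a b k (z τ)) (uIcc s t) :=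
    (dampingCLM hNd L a b k).continuous.comp_continuousOn (hz.mono hsub)
  have hci : IntervalIntegrable (fun τ => dampingCLM hNd L a b k (z τ)) volume s t :=
    hc.intervalIntegrable
  rw [intervalIntegrable_iff] at hci ⊢
  refine Integrable.mono hci ((hα k).aestronglyMeasurable.restrict.smul hci.aestronglyMeasurable) ?_
  filter_upwards [ae_restrict_of_ae (hα1 k)] with τ hτ
  rw [norm_smul, Real.norm_eq_abs, abs_of_nonneg hτ.1]
  exact mul_le_of_le_one_left (norm_nonneg _) hτ.2

end Network

/-! ### Continuity in time of the translates -/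

/-- Continuity in `Lᵖ(0, ℓ)` of `t ↦ (x ↦ v (t - x) * G t x)`, where `G` is bounded by one and
Lipschitz in time. -/
lemma continuous_of_coeFn_eq_translate {ℓ : ℝ} {p : ℝ≥0∞} [Fact (1 ≤ p)] (hp : p ≠ ∞)
    {v : ℝ → ℝ} (hv : ∀ T, MemLp ((Iio T).indicator v) p volume) {G : ℝ → ℝ → ℝ}
    (hG : ∀ t x, |G t x| ≤ 1) {κ : ℝ} (hGt : ∀ t t' x, |G t x - G t' x| ≤ κ * |t - t'|)
    {z : ℝ → Lp ℝ p (volume.restrict (Ioo 0 ℓ))}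
    (hz : ∀ t, z t =ᵐ[volume.restrict (Ioo 0 ℓ)] fun x => v (t - x) * G t x) : Continuous z := by
  rw [continuous_iff_continuousAt]
  intro t₀
  -- Cutting `v` off at `t₀ + 1` makes it an `Lᵖ` function on the line. For `t < t₀ + 1` and `x > 0`
  -- the cutoff is not felt, so continuity of translations in `Lᵖ`, `p < ∞`, applies near `t₀`.
  set V : Lp ℝ p (volume : Measure ℝ) := (hv (t₀ + 1)).toLp _ with hV
  let φ : C(ℝ × ℝ, ℝ) := ⟨fun z => z.1 - z.2, by fun_prop⟩
  have hφ : ∀ t, MeasurePreserving (φ.curry t) volume volume := fun t =>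
    Measure.measurePreserving_sub_left volume t
  set W : ℝ → Lp ℝ p (volume.restrict (Ioo 0 ℓ)) := fun t =>
    LpToLpRestrictCLM ℝ ℝ ℝ volume p (Ioo 0 ℓ) (Lp.compMeasurePreserving (φ.curry t) (hφ t) V)
    with hW
  have hWc : Continuous W := (LpToLpRestrictCLM ℝ ℝ ℝ volume p (Ioo 0 ℓ)).continuous.comp
    (continuous_const.compMeasurePreservingLp φ.curry.continuous hφ hp)
  have hWv : ∀ t < t₀ + 1, W t =ᵐ[volume.restrict (Ioo 0 ℓ)] fun x => v (t - x) := by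
    intro t ht
    have h1 := LpToLpRestrictCLM_coeFn (μ := (volume : Measure ℝ)) ℝ (Ioo 0 ℓ)
      (Lp.compMeasurePreserving (φ.curry t) (hφ t) V)
    have h2 := ae_restrict_of_ae (s := Ioo 0 ℓ) (Lp.coeFn_compMeasurePreserving V (hφ t))
    have h3 := ae_restrict_of_ae (s := Ioo 0 ℓ)
      ((hφ t).quasiMeasurePreserving.ae_eq_comp (MemLp.coeFn_toLp (hv (t₀ + 1))))
    filter_upwards [h1, h2, h3, ae_restrict_mem measurableSet_Ioo] with x h1 h2 h3 hx
    have : t - x ∈ Iio (t₀ + 1) := by simp only [mem_Iio]; linarith [hx.1]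
    exact h1.trans (h2.trans (h3.trans (indicator_of_mem this v)))
  have hbound : ∀ᶠ t in nhds t₀, ‖z t - z t₀‖ ≤ ‖W t - W t₀‖ + κ * |t - t₀| * ‖W t₀‖ := by
    filter_upwards [Iio_mem_nhds (lt_add_one t₀)] with t ht
    have hκ : 0 ≤ κ * |t - t₀| := (abs_nonneg _).trans (hGt t t₀ 0)
    have hle : ‖z t - z t₀‖ ≤ ‖|W t - W t₀| + (κ * |t - t₀|) • |W t₀|‖ := by
      refine Lp.norm_le_norm_of_ae_le ?_
      filter_upwards [hz t, hz t₀, hWv t ht, hWv t₀ (lt_add_one t₀), Lp.coeFn_sub (z t) (z t₀),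
        Lp.coeFn_add |W t - W t₀| ((κ * |t - t₀|) • |W t₀|), Lp.coeFn_abs (W t - W t₀),
        Lp.coeFn_smul (κ * |t - t₀|) |W t₀|, Lp.coeFn_abs (W t₀),
        Lp.coeFn_sub (W t) (W t₀)] with x h1 h2 h3 h4 h5 h6 h7 h8 h9 h10
      rw [h5, h6, Pi.sub_apply, Pi.add_apply, h7, h8, Pi.smul_apply, h9, h10, Pi.sub_apply,
        h1, h2, h3, h4, smul_eq_mul, Real.norm_eq_abs, Real.norm_eq_abs,
        abs_of_nonneg (a := |v (t - x) - v (t₀ - x)| + κ * |t - t₀| * |v (t₀ - x)|) (by positivity)]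
      have e : v (t - x) * G t x - v (t₀ - x) * G t₀ x
          = (v (t - x) - v (t₀ - x)) * G t x + v (t₀ - x) * (G t x - G t₀ x) := by ring
      rw [e]
      refine (abs_add_le _ _).trans ?_
      rw [abs_mul, abs_mul, mul_comm (κ * _)]
      gcongr
      · exact mul_le_of_le_one_right (abs_nonneg _) (hG t x)
      · exact hGt t t₀ x
    refine hle.trans ((norm_add_le _ _).trans ?_)
    rw [norm_smul, norm_abs_eq_norm, norm_abs_eq_norm, Real.norm_eq_abs, abs_of_nonneg hκ]
  refine tendsto_iff_norm_sub_tendsto_zero.2 (squeeze_zero' (Filter.Eventually.of_forall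
    fun t => norm_nonneg _) hbound ?_)
  have hcont : Continuous fun t => ‖W t - W t₀‖ + κ * |t - t₀| * ‖W t₀‖ := by fun_prop
  simpa using hcont.tendsto t₀

/-! ### Dissipativity and uniqueness -/

/-- Uniqueness of integrated solutions of `d' = A d + f`, `d 0 = 0`, for a dissipative operator `A`
(given by its graph) and a perturbation `f` that is controlled by `d`. -/
lemma eq_zero_of_dissipative {X : Type*} [NormedAddCommGroup X] [NormedSpace ℝ X] [CompleteSpace X]
    {A : X → X → Prop} {nn : X → ℝ} {c K : ℝ} (hnn_add : ∀ u v, nn (u + v) ≤ nn u + nn v)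
    (hnn_ge : ∀ u, ‖u‖ ≤ nn u) (hnn_le : ∀ u, nn u ≤ c * ‖u‖) (hc : 0 < c) (hK : 0 < K)
    (hdis : ∀ U F, ∀ r : ℝ, 0 < r → A U F → nn U ≤ nn (U - r • F)) {d : ℝ → X} (hd : Continuous d)
    {f : ℝ → ℝ → X}
    (hA : ∀ s t, 0 ≤ s → s ≤ t → A (∫ τ in s..t, d τ) (d t - d s - f s t))
    (hf : ∀ s t S, 0 ≤ s → s ≤ t → (∀ r ∈ Icc s t, ‖d r‖ ≤ S) → ‖f s t‖ ≤ K * S * (t - s))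
    (hd0 : d 0 = 0) {t : ℝ} (ht : 0 ≤ t) : d t = 0 := by
  have hint : ∀ x y, IntervalIntegrable d volume x y := fun x y => hd.intervalIntegrable x y
  set Z : ℝ → X := fun t => ∫ τ in (0 : ℝ)..t, d τ with hZ
  have hZsub : ∀ x y, Z y - Z x = ∫ τ in x..y, d τ := fun x y =>
    intervalIntegral.integral_interval_sub_left (hint _ _) (hint _ _)
  have hZd : ∀ x, HasDerivAt Z (d x) x := fun x =>
    intervalIntegral.integral_hasDerivAt_right (hint _ _)
      hd.stronglyMeasurable.stronglyMeasurableAtFilter hd.continuousAt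
  have hZc : Continuous Z := continuous_iff_continuousAt.2 fun x => (hZd x).continuousAt
  have hnn_sub : ∀ u v, nn u - nn v ≤ c * ‖u - v‖ := fun u v => by
    have h1 := hnn_add (u - v) v
    rw [sub_add_cancel] at h1
    linarith [hnn_le (u - v)]
  have hnnc : Continuous nn := by
    refine LipschitzWith.continuous (K := c.toNNReal) (LipschitzWith.of_dist_le_mul fun u v => ?_)
    rw [Real.dist_eq, dist_eq_norm, Real.coe_toNNReal _ hc.le, abs_sub_le_iff]
    exact ⟨hnn_sub u v, by rw [norm_sub_rev]; exact hnn_sub v u⟩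
  -- The function `d` need not lie in the domain of `A`, but its integrals `U(r)` over `[r, r + h]`
  -- do. Dissipativity bounds `nn (U r)` by roughly `nn` of the earlier value `U (r - ε)`, that is,
  -- it controls backward increments; hence time is reversed before the growth lemma for right
  -- increments is used.
  have stepA : ∀ s e h S, 0 ≤ s → s ≤ e → 0 < h → 0 ≤ S → (∀ r ∈ Icc s (e + h), ‖d r‖ ≤ S) →
      nn (Z (e + h) - Z e) - nn (Z (s + h) - Z s) ≤ c * (K * S * h) * (e - s) := by
    intro s e h S hs hse hh hS hb
    have key := sub_le_of_eventually_increment_le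
      (Φ := fun r => -nn (Z (-r + h) - Z (-r))) (a := -e) (b := -s) (κ := c * (K * S * h))
      (by linarith) (by fun_prop) (fun r hr ε hε => by
        have hderiv : HasDerivAt (fun r => Z (-r + h) - Z (-r)) (-(d (-r + h) - d (-r))) r := by
          have h1 : HasDerivAt (fun r : ℝ => -r + h) (-1) r := (hasDerivAt_neg r).add_const h
          have h2 := (hZd (-r + h)).scomp r h1
          have h3 := (hZd (-r)).scomp r (hasDerivAt_neg r)
          convert! h2.sub h3 using 1
          simp only [neg_smul, one_smul]
          abel
        have hlit := (hasDerivAt_iff_isLittleO.1 hderiv).def (show 0 < ε / c by positivity)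
        filter_upwards [mem_nhdsWithin_of_mem_nhds hlit, self_mem_nhdsWithin] with y hy hry
        have hpos : 0 < y - r := sub_pos.2 hry
        set D := d (-r + h) - d (-r) with hD
        set F := D - f (-r) (-r + h) with hF
        have hr1 : -r ≤ e := by linarith [hr.1]
        have hr2 : s ≤ -r := by linarith [hr.2]
        have h1 : nn (Z (-r + h) - Z (-r)) ≤ nn (Z (-r + h) - Z (-r) - (y - r) • F) :=
          hdis _ _ _ hpos (by rw [hZsub]; exact hA _ _ (by linarith) (by linarith))
        have h2 : ‖f (-r) (-r + h)‖ ≤ K * S * h := by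
          have := hf (-r) (-r + h) S (by linarith) (by linarith)
            (fun q hq => hb q ⟨by linarith [hq.1], by linarith [hq.2]⟩)
          rwa [add_sub_cancel_left] at this
        have h3 := hnn_sub (Z (-r + h) - Z (-r) - (y - r) • F) (Z (-y + h) - Z (-y))
        have h4 : ‖Z (-r + h) - Z (-r) - (y - r) • F - (Z (-y + h) - Z (-y))‖
            ≤ ε / c * (y - r) + (y - r) * (K * S * h) := by
          have e1 : Z (-r + h) - Z (-r) - (y - r) • F - (Z (-y + h) - Z (-y))
              = -(Z (-y + h) - Z (-y) - (Z (-r + h) - Z (-r)) - (y - r) • -D)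
                + (y - r) • f (-r) (-r + h) := by
            rw [hF, smul_sub, smul_neg]; abel
          rw [e1]
          refine (norm_add_le _ _).trans (add_le_add ?_ ?_)
          · rw [norm_neg]
            rwa [Real.norm_eq_abs (y - r), abs_of_pos hpos] at hy
          · rw [norm_smul, Real.norm_eq_abs, abs_of_pos hpos]
            gcongr
        have h5 : c * (ε / c * (y - r) + (y - r) * (K * S * h))
            = (c * (K * S * h) + ε) * (y - r) := by field_simp; ring
        have h6 := mul_le_mul_of_nonneg_left h4 hc.le
        linarith)
    simp only [neg_neg] at key
    linarith
  -- Dividing by `h` and letting `h` tend to zero turns the estimate for integrals into one for `d`.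
  -- The window reaches beyond `e`, hence the slack required in the bound on `d`.
  have stepB : ∀ s e S, 0 ≤ s → s ≤ e → 0 ≤ S → (∃ h > 0, ∀ r ∈ Icc s (e + h), ‖d r‖ ≤ S) →
      ‖d e‖ ≤ c * ‖d s‖ + c * K * S * (e - s) := by
    rintro s e S hs hse hS ⟨h₀, hh₀, hb⟩
    have hlim : ∀ x, Filter.Tendsto (fun h => ‖h⁻¹ • (Z (x + h) - Z x)‖)
        (nhdsWithin 0 (Ioi 0)) (nhds ‖d x‖) := fun x =>
      ((hasDerivAt_iff_tendsto_slope_zero.1 (hZd x)).mono_left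
        (nhdsWithin_mono _ fun y hy => ne_of_gt hy)).norm
    refine le_of_tendsto_of_tendsto (hlim e) (((hlim s).const_mul c).add_const _) ?_
    filter_upwards [Ioo_mem_nhdsGT hh₀] with h hh
    have hA' := stepA s e h S hs hse hh.1 hS fun r hr => hb r ⟨hr.1, by linarith [hr.2, hh.2]⟩
    have h1 := hnn_ge (Z (e + h) - Z e)
    have h2 := hnn_le (Z (s + h) - Z s)
    rw [norm_smul, norm_smul, Real.norm_eq_abs, abs_of_pos (inv_pos.2 hh.1)]
    have hi := inv_pos.2 hh.1
    calc h⁻¹ * ‖Z (e + h) - Z e‖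
        ≤ h⁻¹ * (c * ‖Z (s + h) - Z s‖ + c * (K * S * h) * (e - s)) := by gcongr; linarith
      _ = c * (h⁻¹ * ‖Z (s + h) - Z s‖) + c * K * S * (e - s) := by
          have := hh.1.ne'
          field_simp
  -- On a time step of this length the estimate gives half the supremum as a bound for the supremum,
  -- which therefore vanishes.
  set δ : ℝ := 1 / (2 * (c * K)) with hδ
  have hδ0 : 0 < δ := by positivity
  have stepC : ∀ s, 0 ≤ s → d s = 0 → ∀ e ∈ Icc s (s + δ), d e = 0 := by
    intro s hs hds
    obtain ⟨m, hm, hmax⟩ := isCompact_Icc.exists_isMaxOn (nonempty_Icc.2 (by linarith : s ≤ s + δ))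
      hd.norm.continuousOn
    set S := ‖d m‖ with hS
    have hhalf : ∀ e ∈ Ico s (s + δ), ‖d e‖ ≤ S / 2 := by
      intro e he
      have := stepB s e S hs he.1 (norm_nonneg _) ⟨s + δ - e, by linarith [he.2], fun r hr =>
        hmax ⟨hr.1, by linarith [hr.2]⟩⟩
      rw [hds, norm_zero, mul_zero, zero_add] at this
      calc ‖d e‖ ≤ c * K * S * (e - s) := this
        _ ≤ c * K * S * δ := by
            have : 0 ≤ S := norm_nonneg _
            gcongr
            linarith [he.2]
        _ = S / 2 := by rw [hδ]; field_simp
    have hhalf' : ∀ e ∈ Icc s (s + δ), ‖d e‖ ≤ S / 2 := by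
      rw [← closure_Ico (by linarith : s ≠ s + δ)]
      exact le_on_closure hhalf hd.norm.continuousOn continuousOn_const
    have hS0 : S ≤ S / 2 := hhalf' m hm
    intro e he
    have := hhalf' e he
    exact norm_le_zero_iff.1 (by linarith)
  have stepD : ∀ n : ℕ, ∀ e ∈ Icc 0 (n * δ), d e = 0 := by
    intro n
    induction n with
    | zero =>
      intro e he
      have : e = 0 := le_antisymm (by simpa using he.2) he.1
      rw [this, hd0]
    | succ n ih =>
      intro e he
      rcases le_total e (n * δ) with h | h
      · exact ih e ⟨he.1, h⟩
      · have hn : 0 ≤ n * δ := by positivity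
        refine stepC (n * δ) hn (ih _ ⟨hn, le_rfl⟩) e ⟨h, ?_⟩
        have := he.2
        push_cast at this
        linarith
  obtain ⟨n, hn⟩ := exists_nat_ge (t / δ)
  exact stepD n t ⟨ht, by rwa [div_le_iff₀ hδ0] at hn⟩

/-- The `L¹` estimate for the resolvent equation `v + r v' = g` on an interval. -/
lemma abs_add_integral_abs_le {ℓ r : ℝ} (hℓ : 0 ≤ ℓ) (hr : 0 < r) {v W : ℝ → ℝ}
    (hW : IntervalIntegrable W volume 0 ℓ)
    (hv : ∀ x ∈ Icc 0 ℓ, v x = v 0 + ∫ s in (0 : ℝ)..x, W s) :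
    |v ℓ| + (1 / r) * ∫ x in (0 : ℝ)..ℓ, |v x|
      ≤ |v 0| + (1 / r) * ∫ x in (0 : ℝ)..ℓ, |v x + r * W x| := by
  have hsub : ∀ {x y : ℝ}, 0 ≤ x → x ≤ y → y ≤ ℓ → uIcc x y ⊆ uIcc 0 ℓ := by
    intro x y h1 h2 h3
    rw [uIcc_of_le h2, uIcc_of_le hℓ]
    exact Icc_subset_Icc h1 h3
  have hvc : ContinuousOn v (Icc 0 ℓ) := by
    have h1 : ContinuousOn (fun x => v 0 + ∫ s in (0 : ℝ)..x, W s) (Icc 0 ℓ) := by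
      have := intervalIntegral.continuousOn_primitive_interval' hW left_mem_uIcc
      rw [uIcc_of_le hℓ] at this
      exact continuousOn_const.add this
    exact h1.congr hv
  have hvi : IntervalIntegrable v volume 0 ℓ := by
    refine ContinuousOn.intervalIntegrable ?_
    rwa [uIcc_of_le hℓ]
  have hg : IntervalIntegrable (fun x => v x + r * W x) volume 0 ℓ := hvi.add (hW.const_mul r)
  -- Formally, `|v|' ≤ (|g| - |v|) / r` with `g = v + r v'`, so `Φ` does not increase. Finite
  -- increments replace the derivative of the absolute value.
  set Φ : ℝ → ℝ := fun x => |v x| + (1 / r) * (∫ s in (0 : ℝ)..x, |v s|)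
    - (1 / r) * ∫ s in (0 : ℝ)..x, |v s + r * W s| with hΦ
  have hΦc : ContinuousOn Φ (Icc 0 ℓ) := by
    have h1 := intervalIntegral.continuousOn_primitive_interval' hvi.abs left_mem_uIcc
    have h2 := intervalIntegral.continuousOn_primitive_interval' hg.abs left_mem_uIcc
    rw [uIcc_of_le hℓ] at h1 h2
    exact (hvc.abs.add (continuousOn_const.mul h1)).sub (continuousOn_const.mul h2)
  have key := sub_le_of_eventually_increment_le (κ := 0) hℓ hΦc (fun x hx ε hε => by
    have hcx : ContinuousWithinAt v (Icc 0 ℓ) x := hvc x ⟨hx.1, hx.2.le⟩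
    -- The oscillation of `v` enters twice, in `hvabs` and in `hvy'`; hence the factor `1 / 2`.
    obtain ⟨η, hη, hosc⟩ := Metric.continuousWithinAt_iff.1 hcx (ε * r / 2) (by positivity)
    have hη' : x < min (min (x + η) (x + r)) ℓ := by
      refine lt_min (lt_min ?_ ?_) hx.2 <;> linarith
    filter_upwards [Ioo_mem_nhdsGT hη'] with y hy
    have hxy := hy.1
    have hy1 : y < x + η := hy.2.trans_le ((min_le_left _ _).trans (min_le_left _ _))
    have hy2 : y < x + r := hy.2.trans_le ((min_le_left _ _).trans (min_le_right _ _))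
    have hy3 : y < ℓ := hy.2.trans_le (min_le_right _ _)
    have h0y : 0 ≤ y := hx.1.trans hxy.le
    have i1 : ∀ {f : ℝ → ℝ}, IntervalIntegrable f volume 0 ℓ →
        (∫ s in (0 : ℝ)..y, f s) - (∫ s in (0 : ℝ)..x, f s) = ∫ s in x..y, f s := fun hf =>
      intervalIntegral.integral_interval_sub_left
        (hf.mono_set (hsub le_rfl h0y hy3.le)) (hf.mono_set (hsub le_rfl hx.1 hx.2.le))
    have hmono : ∀ {f : ℝ → ℝ}, IntervalIntegrable f volume 0 ℓ →
        IntervalIntegrable f volume x y := fun hf => hf.mono_set (hsub hx.1 hxy.le hy3.le)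
    have hdev : ∀ s ∈ Icc x y, |v s - v x| ≤ ε * r / 2 := fun s hs => by
      have := hosc (x := s) ⟨hx.1.trans hs.1, hs.2.trans hy3.le⟩ (by
        rw [Real.dist_eq, abs_of_nonneg (sub_nonneg.2 hs.1)]; linarith [hs.2])
      rw [Real.dist_eq] at this
      exact this.le
    have hvx : IntervalIntegrable (fun s => v s - v x) volume x y :=
      (hmono hvi).sub intervalIntegrable_const
    set O : ℝ := ∫ s in x..y, |v s - v x| with hO
    have hO1 : O ≤ ε * r / 2 * (y - x) := by
      have := intervalIntegral.integral_mono_on hxy.le hvx.abs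
        (intervalIntegrable_const (c := ε * r / 2)) hdev
      rw [intervalIntegral.integral_const, smul_eq_mul] at this
      linarith
    have hvabs : ∫ s in x..y, |v s| ≤ (y - x) * |v x| + O := by
      have := intervalIntegral.integral_mono_on hxy.le (hmono hvi).abs
        ((intervalIntegrable_const (c := |v x|)).add hvx.abs) (fun s _ => by
          have := abs_add_le (v x) (v s - v x)
          rwa [add_sub_cancel] at this)
      rwa [intervalIntegral.integral_add intervalIntegrable_const hvx.abs,
        intervalIntegral.integral_const, smul_eq_mul] at this
    -- For `y < x + r` the coefficient of `v x` is positive, so that the triangle inequality loses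
    -- nothing to first order in `y - x`.
    have hvy : r * v y = (r - (y - x)) * v x + (∫ s in x..y, (v s + r * W s))
        - ∫ s in x..y, (v s - v x) := by
      have e1 : v y = v x + ∫ s in x..y, W s := by
        rw [← i1 hW, hv y ⟨h0y, hy3.le⟩, hv x ⟨hx.1, hx.2.le⟩]; ring
      rw [e1, intervalIntegral.integral_add (hmono hvi) ((hmono hW).const_mul r),
        intervalIntegral.integral_sub (hmono hvi) intervalIntegrable_const,
        intervalIntegral.integral_const, intervalIntegral.integral_const_mul, smul_eq_mul]
      ring
    have hvy' : r * |v y| ≤ (r - (y - x)) * |v x| + (∫ s in x..y, |v s + r * W s|) + O := by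
      rw [← abs_of_pos hr, ← abs_mul, abs_of_pos hr, hvy]
      refine (abs_sub _ _).trans (add_le_add ((abs_add_le _ _).trans (add_le_add ?_ ?_)) ?_)
      · rw [abs_mul, abs_of_pos (by linarith : 0 < r - (y - x))]
      · exact intervalIntegral.abs_integral_le_integral_abs hxy.le
      · exact intervalIntegral.abs_integral_le_integral_abs hxy.le
    have e2 := i1 hvi.abs
    have e3 := i1 hg.abs
    have hfin : r * (Φ y - Φ x) ≤ r * ((0 + ε) * (y - x)) := by
      have e4 : r * (Φ y - Φ x) = r * |v y| - r * |v x| + (∫ s in x..y, |v s|)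
          - ∫ s in x..y, |v s + r * W s| := by
        rw [← e2, ← e3, hΦ]
        field_simp
        ring
      rw [e4]
      nlinarith
    exact le_of_mul_le_mul_left hfin hr)
  simp only [hΦ, intervalIntegral.integral_same] at key
  linarith

/-! ### Dissipativity of the transport operator; uniqueness of solutions -/

section Network

variable {N Nd : ℕ} {L : Fin N → ℝ} {M : Matrix (Fin N) (Fin N) ℝ}

lemma intervalIntegrable_coeFn_Lp {ℓ : ℝ} (hℓ : 0 ≤ ℓ) {p : ℝ≥0∞} [Fact (1 ≤ p)]
    (u : Lp ℝ p (volume.restrict (Ioo 0 ℓ))) : IntervalIntegrable u volume 0 ℓ := by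
  rw [intervalIntegrable_iff_integrableOn_Ioo_of_le hℓ]
  exact (Lp.memLp u).integrable Fact.out

lemma IsSobolevRepr.abs_add_norm_le {ℓ r : ℝ} (hℓ : 0 ≤ ℓ) (hr : 0 < r)
    {U W : Lp ℝ 1 (volume.restrict (Ioo 0 ℓ))} {v : ℝ → ℝ} (h : IsSobolevRepr U W v) :
    |v ℓ| + (1 / r) * ‖U‖ ≤ |v 0| + (1 / r) * ‖U + r • W‖ := by
  have key := abs_add_integral_abs_le hℓ hr (intervalIntegrable_coeFn_Lp hℓ W) h.1
  rw [L1.norm_eq_integral_norm, L1.norm_eq_integral_norm]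
  rw [intervalIntegral.integral_of_le hℓ, intervalIntegral.integral_of_le hℓ,
    integral_Ioc_eq_integral_Ioo, integral_Ioc_eq_integral_Ioo] at key
  convert key using 3
  · refine integral_congr_ae ?_
    filter_upwards [h.2] with x hx
    rw [hx, Real.norm_eq_abs]
  · refine integral_congr_ae ?_
    filter_upwards [h.2, Lp.coeFn_add U (r • W), Lp.coeFn_smul r W] with x hx h1 h2
    rw [h1, Pi.add_apply, h2, hx, Real.norm_eq_abs, Pi.smul_apply, smul_eq_mul]

/-- The transport operator is dissipative for the `L¹` norm if the columns of `M` have `ℓ¹` norm at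
most one. -/
lemma IsTransport.sum_norm_le (hL : ∀ i, 0 < L i) (hM : ∀ j, ∑ i, |M i j| ≤ 1)
    {U F : NetworkSpace L 1} (h : IsTransport L M U F) {r : ℝ} (hr : 0 < r) :
    ∑ i, ‖U i‖ ≤ ∑ i, ‖(U - r • F) i‖ := by
  obtain ⟨v, hv, hbc⟩ := h
  have h1 : ∑ i, (|v i (L i)| + (1 / r) * ‖U i‖)
      ≤ ∑ i, (|v i 0| + (1 / r) * ‖(U - r • F) i‖) := by
    refine Finset.sum_le_sum fun i _ => ?_
    have := (hv i).abs_add_norm_le (hL i).le hr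
    rwa [smul_neg, ← sub_eq_add_neg] at this
  -- The vertex does not create `ℓ¹` mass, so the boundary terms can be dropped.
  have h2 : ∑ i, |v i 0| ≤ ∑ i, |v i (L i)| := by
    calc ∑ i, |v i 0| ≤ ∑ i, ∑ j, |M i j| * |v j (L j)| := by
          refine Finset.sum_le_sum fun i _ => ?_
          rw [hbc i]
          refine (Finset.abs_sum_le_sum_abs _ _).trans (le_of_eq ?_)
          simp only [abs_mul]
      _ = ∑ j, (∑ i, |M i j|) * |v j (L j)| := by
          rw [Finset.sum_comm]
          simp only [Finset.sum_mul]
      _ ≤ ∑ i, |v i (L i)| :=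
          Finset.sum_le_sum fun j _ => mul_le_of_le_one_left (abs_nonneg _) (hM j)
  rw [Finset.sum_add_distrib, Finset.sum_add_distrib, ← Finset.mul_sum, ← Finset.mul_sum] at h1
  have h3 : (1 / r) * ∑ i, ‖U i‖ ≤ (1 / r) * ∑ i, ‖(U - r • F) i‖ := by linarith
  exact le_of_mul_le_mul_left h3 (by positivity)

lemma IsSobolevRepr.sub {ℓ : ℝ} (hℓ : 0 ≤ ℓ) {p : ℝ≥0∞} [Fact (1 ≤ p)]
    {U W U' W' : Lp ℝ p (volume.restrict (Ioo 0 ℓ))} {v v' : ℝ → ℝ} (h : IsSobolevRepr U W v)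
    (h' : IsSobolevRepr U' W' v') : IsSobolevRepr (U - U') (W - W') (v - v') := by
  refine ⟨fun x hx => ?_, ?_⟩
  · have hs : uIcc 0 x ⊆ uIcc 0 ℓ := by
      rw [uIcc_of_le hx.1, uIcc_of_le hℓ]; exact Icc_subset_Icc le_rfl hx.2
    have e : ∫ s in (0 : ℝ)..x, (W - W' : Lp ℝ p (volume.restrict (Ioo 0 ℓ))) s
        = ∫ s in (0 : ℝ)..x, (W s - W' s) := by
      rw [intervalIntegral.integral_of_le hx.1, intervalIntegral.integral_of_le hx.1,
        integral_Ioc_eq_integral_Ioo, integral_Ioc_eq_integral_Ioo]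
      exact integral_congr_ae (ae_restrict_of_ae_restrict_of_subset
        (Ioo_subset_Ioo le_rfl hx.2) (Lp.coeFn_sub W W'))
    rw [e, intervalIntegral.integral_sub ((intervalIntegrable_coeFn_Lp hℓ W).mono_set hs)
      ((intervalIntegrable_coeFn_Lp hℓ W').mono_set hs), Pi.sub_apply, Pi.sub_apply, h.1 x hx,
      h'.1 x hx]
    ring
  · filter_upwards [h.2, h'.2, Lp.coeFn_sub U U'] with x h1 h2 h3
    rw [h3, Pi.sub_apply, Pi.sub_apply, h1, h2]

lemma IsTransport.sub (hL : ∀ i, 0 < L i) {p : ℝ≥0∞} [Fact (1 ≤ p)] {U F U' F' : NetworkSpace L p}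
    (h : IsTransport L M U F) (h' : IsTransport L M U' F') :
    IsTransport L M (U - U') (F - F') := by
  obtain ⟨v, hv, hbc⟩ := h
  obtain ⟨v', hv', hbc'⟩ := h'
  refine ⟨v - v', fun i => ?_, fun i => ?_⟩
  · have := (hv i).sub (hL i).le (hv' i)
    rw [neg_sub_neg] at this
    change IsSobolevRepr (U i - U' i) (-(F i - F' i)) (v i - v' i)
    rwa [neg_sub]
  · simp only [Pi.sub_apply, hbc i, hbc' i, mul_sub, Finset.sum_sub_distrib]

lemma IsTransport.map_lowerExponent {p q : ℝ≥0∞} [Fact (1 ≤ p)] [Fact (1 ≤ q)]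
    (hqp : q ≤ p) {U F : NetworkSpace L p} (h : IsTransport L M U F) :
    IsTransport L M (lowerExponent L hqp U) (lowerExponent L hqp F) := by
  obtain ⟨v, hv, hbc⟩ := h
  refine ⟨v, fun i => ⟨fun x hx => ?_, ?_⟩, hbc⟩
  · rw [(hv i).1 x hx, intervalIntegral.integral_of_le hx.1, intervalIntegral.integral_of_le hx.1,
      integral_Ioc_eq_integral_Ioo, integral_Ioc_eq_integral_Ioo]
    congr 1
    refine integral_congr_ae (ae_restrict_of_ae_restrict_of_subset
        (Ioo_subset_Ioo le_rfl hx.2) ?_)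
    filter_upwards [Lp.coeFn_neg (F i), Lp.coeFn_neg (lowerExponent L hqp F i),
      coeFn_lowerExponentLp hqp (F i)] with s h1 h2 h3
    rw [h1, h2, Pi.neg_apply, Pi.neg_apply, ← h3]
    rfl
  · filter_upwards [(hv i).2, coeFn_lowerExponentLp hqp (U i)] with s h1 h2
    rw [← h1]
    exact h2

lemma lowerExponent_dampingOp (hNd : Nd ≤ N) (a b : Fin Nd → ℝ) {p q : ℝ≥0∞} [Fact (1 ≤ p)]
    [Fact (1 ≤ q)] (hqp : q ≤ p) (k : Fin Nd) (u : NetworkSpace L p) :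
    lowerExponent L hqp (dampingOp hNd L a b k u)
      = dampingOp hNd L a b k (lowerExponent L hqp u) := by
  funext i
  change lowerExponentLp hqp (dampingOp hNd L a b k u i) = _
  rcases eq_or_ne i (Fin.castLE hNd k) with rfl | hi
  · simp only [dampingOp, Pi.single_eq_same, map_neg]
    congr 1
    refine Lp.ext ?_
    filter_upwards [coeFn_lowerExponentLp hqp (mulCharFun (a k) (b k) (u (Fin.castLE hNd k))),
      coeFn_mulCharFun (a k) (b k) (u (Fin.castLE hNd k)),
      coeFn_mulCharFun (a k) (b k) (lowerExponent L hqp u (Fin.castLE hNd k)),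
      coeFn_lowerExponentLp hqp (u (Fin.castLE hNd k))] with x h1 h2 h3 h4
    rw [h1, h2, h3]
    by_cases hx : x ∈ Icc (a k) (b k)
    · rw [indicator_of_mem hx, indicator_of_mem hx]; exact h4.symm
    · rw [indicator_of_notMem hx, indicator_of_notMem hx]
  · simp only [dampingOp, Pi.single_eq_of_ne hi, map_zero]

/-- The inclusion is linear and continuous, so it commutes with the Bochner integrals; it also
commutes with the damping operators and respects the graph of `A`. Thus uniqueness need only be
proved in `L¹`. -/
lemma IsMildSolution.map_lowerExponent (hNd : Nd ≤ N) {a b : Fin Nd → ℝ}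
    {α : Fin Nd → ℝ → ℝ} (hα : ∀ k, AEMeasurable (α k))
    (hα1 : ∀ k, ∀ᵐ s, α k s ∈ Icc (0 : ℝ) 1) {p q : ℝ≥0∞} [Fact (1 ≤ p)] [Fact (1 ≤ q)]
    (hqp : q ≤ p) {z₀ : NetworkSpace L p} {z : ℝ → NetworkSpace L p}
    (h : IsMildSolution hNd L M a b α p z₀ z) :
    IsMildSolution hNd L M a b α q (lowerExponent L hqp z₀) fun t => lowerExponent L hqp (z t) := by
  obtain ⟨hc, h0, ht⟩ := h
  refine ⟨(lowerExponentCLM L hqp).continuous.comp_continuousOn hc, by simp only [h0], fun t ht0 => ?_⟩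
  have key := (ht t ht0).map_lowerExponent hqp
  have hzi : IntervalIntegrable z volume 0 t :=
    (hc.mono fun r hr => by rw [uIcc_of_le ht0] at hr; exact hr.1).intervalIntegrable
  have hdi := intervalIntegrable_damping hNd L a b hα hα1 hc le_rfl ht0
  simp only [← lowerExponentCLM_apply, map_sub] at key
  rw [← ContinuousLinearMap.intervalIntegral_comp_comm _ hzi,
    ← ContinuousLinearMap.intervalIntegral_comp_comm _ hdi] at key
  simp only [map_sum, map_smul, lowerExponentCLM_apply, lowerExponent_dampingOp] at key
  exact key

/-- Uniqueness of mild solutions in `L¹`. -/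
lemma IsMildSolution.eq_of_exponent_one (hNd : Nd ≤ N) (hN : 0 < N) (hNd0 : 0 < Nd)
    (hL : ∀ i, 0 < L i)
    (hM : ∀ j, ∑ i, |M i j| ≤ 1) {a b : Fin Nd → ℝ}
    {α : Fin Nd → ℝ → ℝ} (hα : ∀ k, AEMeasurable (α k))
    (hα1 : ∀ k, ∀ᵐ s, α k s ∈ Icc (0 : ℝ) 1)
    {z₀ : NetworkSpace L 1} {z z' : ℝ → NetworkSpace L 1}
    (h : IsMildSolution hNd L M a b α 1 z₀ z) (h' : IsMildSolution hNd L M a b α 1 z₀ z') {t : ℝ}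
    (ht : 0 ≤ t) : z t = z' t := by
  -- Freezing negative times at zero makes the difference continuous on the whole line.
  set d : ℝ → NetworkSpace L 1 := fun t => z (max t 0) - z' (max t 0) with hd
  have hmax : Continuous fun t : ℝ => max t 0 := by fun_prop
  have hdc : Continuous d :=
    (h.1.comp_continuous hmax fun x => mem_Ici.2 (le_max_right _ _)).sub
      (h'.1.comp_continuous hmax fun x => mem_Ici.2 (le_max_right _ _))
  have hzi : ∀ {z : ℝ → NetworkSpace L 1}, ContinuousOn z (Ici 0) → ∀ s t, 0 ≤ s → 0 ≤ t →
      IntervalIntegrable z volume s t := fun hz s t hs ht =>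
    (hz.mono fun r hr => (le_min hs ht).trans hr.1).intervalIntegrable
  have hB : ∀ {z : ℝ → NetworkSpace L 1}, ContinuousOn z (Ici 0) → ∀ s t, 0 ≤ s → 0 ≤ t →
      IntervalIntegrable (fun τ => ∑ k, α k τ • dampingOp hNd L a b k (z τ)) volume s t :=
    fun hz s t hs ht => intervalIntegrable_damping hNd L a b hα hα1 hz hs ht
  have key : d t = 0 := by
    -- The sum norm, for which `A` is dissipative, is at most `N` times the maximum norm of the
    -- product; the damping is a sum of `Nd` operators of norm at most one with coefficients in `[0,
    -- 1]`.
    refine eq_zero_of_dissipative (A := IsTransport L M) (nn := fun u => ∑ i, ‖u i‖) (c := N)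
      (K := Nd) (f := fun s t => ∫ τ in s..t, ∑ k, α k τ • dampingOp hNd L a b k (d τ))
      ?_ ?_ ?_ (by exact_mod_cast hN) (by exact_mod_cast hNd0)
      (fun U F r hr hUF => hUF.sum_norm_le hL hM hr) hdc ?_ ?_ ?_ ht
    · intro u v
      rw [← Finset.sum_add_distrib]
      exact Finset.sum_le_sum fun i _ => norm_add_le _ _
    · intro u
      refine (pi_norm_le_iff_of_nonneg (Finset.sum_nonneg fun i _ => norm_nonneg _)).2 fun i => ?_
      exact Finset.single_le_sum (f := fun i => ‖u i‖) (fun i _ => norm_nonneg _)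
        (Finset.mem_univ i)
    · intro u
      refine (Finset.sum_le_sum fun i _ => norm_le_pi_norm u i).trans (le_of_eq ?_)
      simp
    · intro s t hs hst
      have ht0 := hs.trans hst
      have h1 := ((h.2.2 t ht0).sub hL (h.2.2 s hs)).sub hL
        ((h'.2.2 t ht0).sub hL (h'.2.2 s hs))
      rw [intervalIntegral.integral_interval_sub_left (hzi h.1 _ _ le_rfl ht0)
          (hzi h.1 _ _ le_rfl hs),
        intervalIntegral.integral_interval_sub_left (hzi h'.1 _ _ le_rfl ht0)
          (hzi h'.1 _ _ le_rfl hs),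
        ← intervalIntegral.integral_sub (hzi h.1 _ _ hs ht0) (hzi h'.1 _ _ hs ht0)] at h1
      have e1 : ∫ τ in s..t, d τ = ∫ τ in s..t, (z τ - z' τ) := by
        refine intervalIntegral.integral_congr fun τ hτ => ?_
        rw [uIcc_of_le hst] at hτ
        simp only [hd, max_eq_left (hs.trans hτ.1)]
      have e2 : ∫ τ in s..t, ∑ k, α k τ • dampingOp hNd L a b k (d τ)
          = (∫ τ in s..t, ∑ k, α k τ • dampingOp hNd L a b k (z τ))
            - ∫ τ in s..t, ∑ k, α k τ • dampingOp hNd L a b k (z' τ) := by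
        rw [← intervalIntegral.integral_sub (hB h.1 _ _ hs ht0) (hB h'.1 _ _ hs ht0)]
        refine intervalIntegral.integral_congr fun τ hτ => ?_
        rw [uIcc_of_le hst] at hτ
        simp only [hd, max_eq_left (hs.trans hτ.1), ← dampingCLM_apply, map_sub, smul_sub,
          Finset.sum_sub_distrib]
      rw [e1, e2]
      convert h1 using 1
      rw [← intervalIntegral.integral_interval_sub_left (hB h.1 0 t le_rfl ht0)
          (hB h.1 0 s le_rfl hs),
        ← intervalIntegral.integral_interval_sub_left (hB h'.1 0 t le_rfl ht0)
          (hB h'.1 0 s le_rfl hs)]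
      simp only [hd, max_eq_left ht0, max_eq_left hs]
      abel
    · intro s t S hs hst hS
      have := intervalIntegral.norm_integral_le_of_norm_le_const_ae (a := s) (b := t)
        (f := fun τ => ∑ k, α k τ • dampingOp hNd L a b k (d τ)) (C := Nd * S) ?_
      · rwa [abs_of_nonneg (sub_nonneg.2 hst)] at this
      · filter_upwards [ae_all_iff.2 hα1] with τ hα1τ hτ
        rw [uIoc_of_le hst] at hτ
        have hk : ∀ k ∈ Finset.univ, ‖α k τ • dampingOp hNd L a b k (d τ)‖ ≤ S := fun k _ => by
          rw [norm_smul, Real.norm_eq_abs, abs_of_nonneg (hα1τ k).1]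
          refine (mul_le_of_le_one_left (norm_nonneg _) (hα1τ k).2).trans ?_
          refine le_trans ?_ (hS τ ⟨hτ.1.le, hτ.2⟩)
          rw [dampingOp, Pi.norm_single, norm_neg]
          exact (norm_mulCharFun_le _ _ _).trans (norm_le_pi_norm (d τ) _)
        refine (norm_sum_le_of_le _ hk).trans (le_of_eq ?_)
        simp
    · simp only [hd, max_self, h.2.1, h'.2.1, sub_self]
  simpa [hd, max_eq_left ht, sub_eq_zero] using key

lemma IsTransportSolution.isMildSolution_one (hNd : Nd ≤ N)
    {a b : Fin Nd → ℝ} {α : Fin Nd → ℝ → ℝ} (hα : ∀ k, AEMeasurable (α k))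
    (hα1 : ∀ k, ∀ᵐ s, α k s ∈ Icc (0 : ℝ) 1) {p : ℝ≥0∞} [hp : Fact (1 ≤ p)]
    {z₀ : NetworkSpace L p} {z : ℝ → NetworkSpace L p}
    (h : IsTransportSolution hNd L M a b α p z₀ z) :
    IsMildSolution hNd L M a b α 1 (lowerExponent L hp.out z₀)
      fun t => lowerExponent L hp.out (z t) := by
  rcases eq_or_ne p ∞ with hp' | hp'
  · exact h.2 hp' 1 hp.out ENNReal.one_ne_top
  · exact (h.1 hp').map_lowerExponent hNd hα hα1 hp.out

/-- Uniqueness of solutions of the damped transport system. -/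
lemma IsTransportSolution.eq (hNd : Nd ≤ N) (hN : 0 < N) (hNd0 : 0 < Nd) (hL : ∀ i, 0 < L i)
    (hM : ∀ j, ∑ i, |M i j| ≤ 1) {a b : Fin Nd → ℝ} {α : Fin Nd → ℝ → ℝ}
    (hα : ∀ k, AEMeasurable (α k)) (hα1 : ∀ k, ∀ᵐ s, α k s ∈ Icc (0 : ℝ) 1) {p : ℝ≥0∞}
    [Fact (1 ≤ p)] {z₀ : NetworkSpace L p} {z z' : ℝ → NetworkSpace L p}
    (h : IsTransportSolution hNd L M a b α p z₀ z)
    (h' : IsTransportSolution hNd L M a b α p z₀ z') {t : ℝ} (ht : 0 ≤ t) : z t = z' t :=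
  lowerExponent_injective L Fact.out <|
    (h.isMildSolution_one hNd hα hα1).eq_of_exponent_one hNd hN hNd0 hL hM hα hα1
      (h'.isMildSolution_one hNd hα hα1) ht

end Network

/-! ### The delay equation for the entry traces -/

section Trace

variable {N : ℕ}

/-- The traces at the vertex produced by the traces `g` of the particles that entered the edges
before, when `E j s` is the damping factor of edge `j` for a particle that enters at time `s`. -/
def vertexStep (L : Fin N → ℝ) (M : Matrix (Fin N) (Fin N) ℝ) (E g : Fin N → ℝ → ℝ) :
    Fin N → ℝ → ℝ :=
  fun i s => ∑ j, M i j * (E j (s - L j) * g j (s - L j))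

/-- The solution of the delay equation `v = f + vertexStep L M E v`, as a Neumann series. -/
def entryTrace (L : Fin N → ℝ) (M : Matrix (Fin N) (Fin N) ℝ) (E f : Fin N → ℝ → ℝ) :
    Fin N → ℝ → ℝ :=
  fun i s => ∑' m : ℕ, (vertexStep L M E)^[m] f i s

variable {L : Fin N → ℝ} {M : Matrix (Fin N) (Fin N) ℝ} {E f g : Fin N → ℝ → ℝ}

lemma measurable_vertexStep (hE : ∀ i, Measurable (E i)) (hg : ∀ i, Measurable (g i)) (i : Fin N) :
    Measurable (vertexStep L M E g i) := by
  refine Finset.measurable_sum _ fun j _ => ?_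
  have h : Measurable fun s : ℝ => s - L j := by fun_prop
  exact measurable_const.mul (((hE j).comp h).mul ((hg j).comp h))

lemma measurable_iterate_vertexStep (hE : ∀ i, Measurable (E i)) (hf : ∀ i, Measurable (f i))
    (m : ℕ) (i : Fin N) : Measurable ((vertexStep L M E)^[m] f i) := by
  induction m generalizing i with
  | zero => exact hf i
  | succ m ih =>
    rw [Function.iterate_succ_apply']
    exact measurable_vertexStep hE ih i

lemma memLp_vertexStep {p : ℝ≥0∞} (hE : ∀ i, Measurable (E i)) (hE0 : ∀ i s, 0 ≤ E i s)
    (hE1 : ∀ i s, E i s ≤ 1) (hg : ∀ i, MemLp (g i) p volume) (i : Fin N) :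
    MemLp (vertexStep L M E g i) p volume := by
  have h : ∀ j, MemLp (fun s => M i j * (E j (s - L j) * g j (s - L j))) p volume := by
    intro j
    have h1 : MemLp (fun s => E j s * g j s) p volume := by
      refine MemLp.mono (hg j) ((hE j).aestronglyMeasurable.mul (hg j).aestronglyMeasurable)
        (Filter.Eventually.of_forall fun s => ?_)
      rw [norm_mul, Real.norm_eq_abs, abs_of_nonneg (hE0 j s)]
      exact mul_le_of_le_one_left (norm_nonneg _) (hE1 j s)
    exact (h1.comp_measurePreserving (measurePreserving_sub_right volume (L j))).const_mul (M i j)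
  exact memLp_finsetSum _ fun j _ => h j

lemma memLp_iterate_vertexStep {p : ℝ≥0∞} (hE : ∀ i, Measurable (E i)) (hE0 : ∀ i s, 0 ≤ E i s)
    (hE1 : ∀ i s, E i s ≤ 1) (hf : ∀ i, MemLp (f i) p volume) (m : ℕ) (i : Fin N) :
    MemLp ((vertexStep L M E)^[m] f i) p volume := by
  induction m generalizing i with
  | zero => exact hf i
  | succ m ih =>
    rw [Function.iterate_succ_apply']
    exact memLp_vertexStep hE hE0 hE1 ih i

lemma exists_ne_zero_of_vertexStep_ne_zero {i : Fin N} {s : ℝ} (h : vertexStep L M E g i s ≠ 0) :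
    ∃ j, g j (s - L j) ≠ 0 := by
  obtain ⟨j, -, hj⟩ := Finset.exists_ne_zero_of_sum_ne_zero h
  exact ⟨j, right_ne_zero_of_mul (right_ne_zero_of_mul hj)⟩

/-- Every passage takes a time between `ℓ` and `Λ`. The lower endpoint makes the Neumann series
locally finite; the upper one shows that early iterates are no longer present at late times. -/
lemma mem_Ioo_of_iterate_vertexStep_ne_zero {ℓ Λ : ℝ} (hℓ : ∀ i, ℓ ≤ L i) (hΛ : ∀ i, L i ≤ Λ)
    (hf : ∀ i s, f i s ≠ 0 → s ∈ Ioo (-L i) 0) (m : ℕ) {i : Fin N} {s : ℝ}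
    (h : (vertexStep L M E)^[m] f i s ≠ 0) : s ∈ Ioo (m * ℓ - Λ) (m * Λ) := by
  induction m generalizing i s with
  | zero =>
    have := hf i s h
    refine ⟨?_, ?_⟩
    · simp only [Nat.cast_zero, zero_mul]; linarith [hΛ i, this.1]
    · simpa using this.2
  | succ m ih =>
    rw [Function.iterate_succ_apply'] at h
    obtain ⟨j, hj⟩ := exists_ne_zero_of_vertexStep_ne_zero h
    have := ih hj
    push_cast
    exact ⟨by linarith [this.1, hℓ j], by linarith [this.2, hΛ j]⟩

lemma pos_of_iterate_vertexStep_ne_zero (hL : ∀ i, 0 < L i)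
    (hf : ∀ i s, f i s ≠ 0 → s ∈ Ioo (-L i) 0) (m : ℕ) {i : Fin N} {s : ℝ}
    (h : (vertexStep L M E)^[m + 1] f i s ≠ 0) : 0 < s := by
  induction m generalizing i s with
  | zero =>
    obtain ⟨j, hj⟩ := exists_ne_zero_of_vertexStep_ne_zero h
    linarith [(hf j _ hj).1]
  | succ m ih =>
    rw [Function.iterate_succ_apply'] at h
    obtain ⟨j, hj⟩ := exists_ne_zero_of_vertexStep_ne_zero h
    linarith [ih hj, hL j]

/-- Expansion of the iterates of `vertexStep` according to the numbers of passages through the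
edges. -/
lemma abs_iterate_vertexStep_le (hE0 : ∀ i s, 0 ≤ E i s) (m : ℕ) (f : Fin N → ℝ → ℝ) (i : Fin N)
    (s : ℝ) :
    |(vertexStep L M E)^[m] f i s| ≤
      ∑ j, ∑ n ∈ Fintype.piFinset fun _ : Fin N => Finset.range (m + 1),
        survival L M E m j (s - ∑ k, n k * L k) * |f j (s - ∑ k, n k * L k)| := by
  induction m generalizing f with
  | zero =>
    have : (Fintype.piFinset fun _ : Fin N => Finset.range (0 + 1)) = {0} := by
      ext n
      simp [funext_iff]
    rw [this]
    simp only [Finset.sum_singleton, survival, Pi.zero_apply, Nat.cast_zero, zero_mul,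
      Finset.sum_const_zero, sub_zero, one_mul, Function.iterate_zero, id_eq]
    exact Finset.single_le_sum (f := fun j => |f j s|) (fun j _ => abs_nonneg _)
      (Finset.mem_univ i)
  | succ m ih =>
    -- The innermost application of `vertexStep`, which is the first passage, is split off. This
    -- matches the recursion of `survival`, where the first edge stands outside the sum.
    rw [Function.iterate_succ_apply]
    refine (ih (vertexStep L M E f)).trans ?_
    rw [Finset.sum_comm]
    set S := Fintype.piFinset fun _ : Fin N => Finset.range (m + 1)
    set S' := Fintype.piFinset fun _ : Fin N => Finset.range (m + 1 + 1)
    set F : Fin N → (Fin N → ℕ) → ℝ := fun j n =>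
      survival L M E (m + 1) j (s - ∑ k, n k * L k) * |f j (s - ∑ k, n k * L k)| with hF
    have hF0 : ∀ j n, 0 ≤ F j n := fun j n => mul_nonneg (survival_nonneg hE0 _ _ _) (abs_nonneg _)
    have hstep : ∀ n : Fin N → ℕ, ∑ k, survival L M E m k (s - ∑ k, n k * L k)
        * |vertexStep L M E f k (s - ∑ k, n k * L k)| ≤ ∑ j, F j (n + Pi.single j 1) := by
      intro n
      set σ := s - ∑ k, n k * L k with hσ
      have hshift : ∀ j, s - ∑ k, ((n + Pi.single j 1 : Fin N → ℕ) k : ℝ) * L k = σ - L j := by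
        intro j
        have : ∑ k, ((n + Pi.single j 1 : Fin N → ℕ) k : ℝ) * L k = ∑ k, n k * L k + L j := by
          simp only [Pi.add_apply, Nat.cast_add, add_mul, Finset.sum_add_distrib]
          congr 1
          rw [Finset.sum_eq_single j (fun k _ hk => by simp [Pi.single_eq_of_ne hk]) (by simp)]
          simp
        rw [this, hσ]
        ring
      have hFj : ∀ j, F j (n + Pi.single j 1)
          = ∑ k, survival L M E m k σ * (|M k j| * (E j (σ - L j) * |f j (σ - L j)|)) := by
        intro j
        simp only [hF, hshift, survival, sub_add_cancel]
        rw [Finset.mul_sum, Finset.sum_mul]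
        refine Finset.sum_congr rfl fun k _ => ?_
        ring
      simp only [hFj]
      rw [Finset.sum_comm]
      refine Finset.sum_le_sum fun k _ => ?_
      rw [← Finset.mul_sum]
      refine mul_le_mul_of_nonneg_left ?_ (survival_nonneg hE0 _ _ _)
      refine (Finset.abs_sum_le_sum_abs _ _).trans (Finset.sum_le_sum fun j _ => ?_)
      rw [abs_mul, abs_mul, abs_of_nonneg (hE0 _ _)]
    refine (Finset.sum_le_sum fun n _ => hstep n).trans ?_
    rw [Finset.sum_comm]
    refine Finset.sum_le_sum fun j _ => ?_
    -- For fixed `j`, one more passage through edge `j` maps multiplicity vectors injectively into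
    -- the larger box, so no delay is counted twice.
    rw [← Finset.sum_image (f := F j) (g := fun n : Fin N → ℕ => n + Pi.single j 1)
      (fun n _ n' _ h => add_right_cancel h)]
    refine Finset.sum_le_sum_of_subset_of_nonneg ?_ fun n _ _ => hF0 j n
    intro n' hn'
    obtain ⟨n, hn, rfl⟩ := Finset.mem_image.1 hn'
    rw [Fintype.mem_piFinset] at hn ⊢
    intro k
    have h1 := Finset.mem_range.1 (hn k)
    have h2 : (Pi.single j 1 : Fin N → ℕ) k ≤ 1 := by
      rcases eq_or_ne k j with rfl | h <;> simp [*]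
    rw [Finset.mem_range, Pi.add_apply]
    omega

/-- All translates of `f j` have the same norm, and there are `(m+1)^N` multiplicity vectors. The
survival bound is only needed after `-Λ`, since `f` vanishes before. Nothing in the constant depends
on `p`. -/
lemma eLpNorm_iterate_vertexStep_le {p : ℝ≥0∞} (hp : 1 ≤ p) {Λ : ℝ} (hE0 : ∀ i s, 0 ≤ E i s)
    (hΛ : ∀ i, L i ≤ Λ) (hf : ∀ i s, f i s ≠ 0 → s ∈ Ioo (-L i) 0)
    (hfm : ∀ i, Measurable (f i)) {m : ℕ} {B : ℝ} (hB0 : 0 ≤ B)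
    (hB : ∀ j s, -Λ ≤ s → survival L M E m j s ≤ B) (i : Fin N) :
    eLpNorm ((vertexStep L M E)^[m] f i) p volume
      ≤ ENNReal.ofReal (B * (m + 1) ^ N) * ∑ j, eLpNorm (f j) p volume := by
  set S := Fintype.piFinset fun _ : Fin N => Finset.range (m + 1)
  have hmt : ∀ (j : Fin N) (n : Fin N → ℕ), Measurable fun s : ℝ => f j (s - ∑ k, n k * L k) :=
    fun j n => (hfm j).comp (measurable_id.sub_const _)
  have hpt : ∀ s, ‖(vertexStep L M E)^[m] f i s‖
      ≤ (B • ∑ j, ∑ n ∈ S, fun s => |f j (s - ∑ k, n k * L k)|) s := by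
    intro s
    refine (abs_iterate_vertexStep_le hE0 m f i s).trans ?_
    simp only [Pi.smul_apply, Finset.sum_apply, smul_eq_mul, Finset.mul_sum]
    refine Finset.sum_le_sum fun j _ => Finset.sum_le_sum fun n _ => ?_
    set σ := s - ∑ k, n k * L k
    rcases eq_or_ne (f j σ) 0 with h | h
    · simp [h]
    · have := (hf j σ h).1
      exact mul_le_mul_of_nonneg_right (hB j σ (by linarith [hΛ j])) (abs_nonneg _)
  refine (eLpNorm_mono_real hpt).trans ?_
  rw [eLpNorm_const_smul, ENNReal.ofReal_mul hB0, mul_assoc]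
  have hnB : ‖B‖ₑ = ENNReal.ofReal B := by rw [Real.enorm_eq_ofReal hB0]
  rw [hnB]
  gcongr
  refine (eLpNorm_sum_le (fun j _ => Finset.aestronglyMeasurable_sum _ fun n _ =>
    (hmt j n).abs.aestronglyMeasurable) hp).trans ?_
  rw [Finset.mul_sum]
  refine Finset.sum_le_sum fun j _ => ?_
  refine (eLpNorm_sum_le (fun n _ => (hmt j n).abs.aestronglyMeasurable) hp).trans ?_
  have hterm : ∀ n ∈ S, eLpNorm (fun s => |f j (s - ∑ k, n k * L k)|) p volume
      = eLpNorm (f j) p volume := by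
    intro n _
    rw [← eLpNorm_comp_measurePreserving (hfm j).aestronglyMeasurable
      (measurePreserving_sub_right volume (∑ k, n k * L k))]
    exact eLpNorm_norm (f j ∘ fun s => s - ∑ k, n k * L k)
  rw [Finset.sum_congr rfl hterm, Finset.sum_const, Fintype.card_piFinset]
  simp only [Finset.card_range, Finset.prod_const, Finset.card_univ, Fintype.card_fin, nsmul_eq_mul]
  refine le_of_eq ?_
  congr 1
  rw [ENNReal.ofReal_pow (by positivity)]
  push_cast
  congr 1
  exact_mod_cast (ENNReal.ofReal_natCast (m + 1)).symm

/-- The iterates of index at least `n` have not started yet at time `s`, so the series is a finite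
sum. -/
lemma hasSum_entryTrace {ℓ Λ : ℝ} (hℓ0 : 0 ≤ ℓ) (hℓ : ∀ i, ℓ ≤ L i) (hΛ : ∀ i, L i ≤ Λ)
    (hf : ∀ i s, f i s ≠ 0 → s ∈ Ioo (-L i) 0) {n : ℕ} {s : ℝ} (hs : s ≤ n * ℓ - Λ) (i : Fin N) :
    HasSum (fun m => (vertexStep L M E)^[m] f i s)
      (∑ m ∈ Finset.range n, (vertexStep L M E)^[m] f i s) := by
  refine hasSum_sum_of_ne_finset_zero fun m hm => ?_
  by_contra h
  have h1 := (mem_Ioo_of_iterate_vertexStep_ne_zero hℓ hΛ hf m h).1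
  have h2 : (n : ℝ) ≤ m := by exact_mod_cast not_lt.1 fun h => hm (Finset.mem_range.2 h)
  nlinarith

/-- The edges have length between two positive constants. -/
lemma exists_edge_length_bounds (hL : ∀ i, 0 < L i) :
    ∃ ℓ Λ : ℝ, 0 < ℓ ∧ 0 < Λ ∧ (∀ i, ℓ ≤ L i) ∧ ∀ i, L i ≤ Λ := by
  rcases isEmpty_or_nonempty (Fin N) with h | h
  · exact ⟨1, 1, one_pos, one_pos, fun i => h.elim i, fun i => h.elim i⟩
  · obtain ⟨i, hi⟩ := Finite.exists_min L
    obtain ⟨j, hj⟩ := Finite.exists_max L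
    exact ⟨L i, L j, hL i, hL j, hi, hj⟩

lemma exists_nat_le_mul_sub {ℓ : ℝ} (hℓ : 0 < ℓ) (Λ s : ℝ) : ∃ n : ℕ, s ≤ n * ℓ - Λ := by
  obtain ⟨n, hn⟩ := exists_nat_ge ((s + Λ) / ℓ)
  rw [div_le_iff₀ hℓ] at hn
  exact ⟨n, by linarith⟩

lemma summable_iterate_vertexStep (hL : ∀ i, 0 < L i)
    (hf : ∀ i s, f i s ≠ 0 → s ∈ Ioo (-L i) 0) (i : Fin N) (s : ℝ) :
    Summable fun m => (vertexStep L M E)^[m] f i s := by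
  obtain ⟨ℓ, Λ, hℓ0, -, hℓ, hΛ⟩ := exists_edge_length_bounds hL
  obtain ⟨n, hn⟩ := exists_nat_le_mul_sub hℓ0 Λ s
  exact (hasSum_entryTrace hℓ0.le hℓ hΛ hf hn i).summable

lemma measurable_entryTrace (hL : ∀ i, 0 < L i) (hE : ∀ i, Measurable (E i))
    (hfm : ∀ i, Measurable (f i)) (hf : ∀ i s, f i s ≠ 0 → s ∈ Ioo (-L i) 0) (i : Fin N) :
    Measurable (entryTrace L M E f i) := by
  refine measurable_of_tendsto_metrizable
    (f := fun n s => ∑ m ∈ Finset.range n, (vertexStep L M E)^[m] f i s)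
    (fun n => Finset.measurable_sum _ fun m _ => measurable_iterate_vertexStep hE hfm m i) ?_
  rw [tendsto_pi_nhds]
  exact fun s => (summable_iterate_vertexStep hL hf i s).hasSum.tendsto_sum_nat

lemma entryTrace_eq_add (hL : ∀ i, 0 < L i) (hf : ∀ i s, f i s ≠ 0 → s ∈ Ioo (-L i) 0)
    (i : Fin N) (s : ℝ) :
    entryTrace L M E f i s = f i s + vertexStep L M E (entryTrace L M E f) i s := by
  have hs := fun i s => summable_iterate_vertexStep (M := M) (E := E) hL hf i s
  rw [entryTrace, (hs i s).tsum_eq_zero_add, Function.iterate_zero, id_eq]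
  congr 1
  simp only [Function.iterate_succ_apply', vertexStep, entryTrace]
  rw [Summable.tsum_finsetSum fun j _ => ((hs j (s - L j)).mul_left _).mul_left _]
  refine Finset.sum_congr rfl fun j _ => ?_
  rw [tsum_mul_left, tsum_mul_left]

lemma entryTrace_of_nonpos (hL : ∀ i, 0 < L i) (hf : ∀ i s, f i s ≠ 0 → s ∈ Ioo (-L i) 0)
    (i : Fin N) {s : ℝ} (hs : s ≤ 0) : entryTrace L M E f i s = f i s := by
  rw [entryTrace, (summable_iterate_vertexStep hL hf i s).tsum_eq_zero_add]
  have : ∀ m, (vertexStep L M E)^[m + 1] f i s = 0 := fun m => by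
    by_contra h
    exact absurd (pos_of_iterate_vertexStep_ne_zero hL hf m h) (not_lt.2 hs)
  simp [this]

lemma entryTrace_of_pos (hL : ∀ i, 0 < L i) (hf : ∀ i s, f i s ≠ 0 → s ∈ Ioo (-L i) 0)
    (i : Fin N) {s : ℝ} (hs : 0 ≤ s) :
    entryTrace L M E f i s
      = ∑ j, M i j * (E j (s - L j) * entryTrace L M E f j (s - L j)) := by
  have h0 : f i s = 0 := by
    by_contra h
    exact absurd (hf i s h).2 (not_lt.2 hs)
  rw [entryTrace_eq_add hL hf, h0, zero_add]
  rfl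

lemma memLp_indicator_entryTrace (hL : ∀ i, 0 < L i) {p : ℝ≥0∞} (hE : ∀ i, Measurable (E i))
    (hE0 : ∀ i s, 0 ≤ E i s) (hE1 : ∀ i s, E i s ≤ 1) (hfp : ∀ i, MemLp (f i) p volume)
    (hf : ∀ i s, f i s ≠ 0 → s ∈ Ioo (-L i) 0) (i : Fin N) (T : ℝ) :
    MemLp ((Iio T).indicator (entryTrace L M E f i)) p volume := by
  obtain ⟨ℓ, Λ, hℓ0, -, hℓ, hΛ⟩ := exists_edge_length_bounds hL
  obtain ⟨n, hn⟩ := exists_nat_le_mul_sub hℓ0 Λ T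
  have h1 : (Iio T).indicator (entryTrace L M E f i) = (Iio T).indicator fun s =>
      ∑ m ∈ Finset.range n, (vertexStep L M E)^[m] f i s := by
    refine indicator_congr fun s hs => ?_
    exact (hasSum_entryTrace hℓ0.le hℓ hΛ hf (hs.le.trans hn) i).tsum_eq
  rw [h1]
  exact (memLp_finsetSum _ fun m _ => memLp_iterate_vertexStep hE hE0 hE1 hfp m i).indicator
    measurableSet_Iio

/-- Exponential decay of the traces, from geometric decay of the surviving mass. -/
lemma exists_eLpNorm_entryTrace_le (hL : ∀ i, 0 < L i) {Λ : ℝ} (hΛ0 : 0 < Λ) (hΛ : ∀ i, L i ≤ Λ)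
    (M : Matrix (Fin N) (Fin N) ℝ) {C η : ℝ} (hC : 0 < C) (hη0 : 0 < η) (hη1 : η < 1) :
    ∃ C' γ : ℝ, 0 < C' ∧ 0 < γ ∧ ∀ (E f : Fin N → ℝ → ℝ) (p : ℝ≥0∞), 1 ≤ p →
      (∀ i, Measurable (E i)) → (∀ i s, 0 ≤ E i s) →
      (∀ m j s, -Λ ≤ s → survival L M E m j s ≤ C * η ^ m) →
      (∀ i, Measurable (f i)) → (∀ i s, f i s ≠ 0 → s ∈ Ioo (-L i) 0) →
      ∀ t, 0 ≤ t → ∀ i,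
        eLpNorm (fun x => entryTrace L M E f i (t - x)) p (volume.restrict (Ioo 0 (L i)))
          ≤ ENNReal.ofReal (C' * Real.exp (-γ * t)) * ∑ j, eLpNorm (f j) p volume := by
  obtain ⟨ℓ, -, hℓ0, -, hℓ, -⟩ := exists_edge_length_bounds hL
  -- Any rate strictly between `η` and one absorbs the polynomial factor `(m+1)^N`.
  set ρ : ℝ := (1 + η) / 2 with hρ
  have hρ0 : 0 < ρ := by positivity
  have hρ1 : ρ < 1 := by linarith
  obtain ⟨B, hB0, hB⟩ : ∃ B : ℝ, 0 < B ∧ ∀ m : ℕ, C * η ^ m * (m + 1) ^ N ≤ B * ρ ^ m := by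
    have hq0 : 0 < η / ρ := by positivity
    have hq1 : |η / ρ| < 1 := by
      rw [abs_of_pos hq0, div_lt_one hρ0]
      linarith
    have ht := tendsto_pow_const_mul_const_pow_of_abs_lt_one N hq1
    obtain ⟨B, hB⟩ := ht.bddAbove_range
    refine ⟨C * (max B 1 / (η / ρ)), by positivity, fun m => ?_⟩
    have h1 := hB (mem_range_self (m + 1))
    simp only [Nat.cast_add, Nat.cast_one] at h1
    have h2 : ((m : ℝ) + 1) ^ N * (η / ρ) ^ m ≤ max B 1 / (η / ρ) := by
      rw [le_div_iff₀ hq0, mul_assoc, ← pow_succ]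
      exact h1.trans (le_max_left _ _)
    calc C * η ^ m * (m + 1) ^ N = C * (((m : ℝ) + 1) ^ N * (η / ρ) ^ m) * ρ ^ m := by
          rw [div_pow]; field_simp
      _ ≤ C * (max B 1 / (η / ρ)) * ρ ^ m := by gcongr
  -- The constant combines the geometric tail with a factor `ρ⁻¹` for rounding `t / Λ` down.
  refine ⟨B / (1 - ρ) * ρ⁻¹, -Real.log ρ / Λ, by
    have : 0 < 1 - ρ := by linarith
    positivity, div_pos (neg_pos.2 (Real.log_neg hρ0 hρ1)) hΛ0, ?_⟩
  intro E f p hp hE hE0 hH hfm hf t ht i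
  obtain ⟨n, hn⟩ := exists_nat_le_mul_sub hℓ0 Λ t
  set m₁ : ℕ := ⌊t / Λ⌋₊ with hm₁
  set F := ∑ j, eLpNorm (f j) p volume
  -- On edge `i` the argument `t - x` exceeds `t - Λ`, while the `m`-th iterate vanishes from time
  -- `m Λ` on. Hence only indices `m ≥ ⌊t / Λ⌋` contribute.
  have h1 : (fun x => entryTrace L M E f i (t - x)) =ᵐ[volume.restrict (Ioo 0 (L i))]
      ∑ m ∈ Finset.Ico m₁ n, (vertexStep L M E)^[m] f i ∘ fun x => t - x := by
    filter_upwards [ae_restrict_mem measurableSet_Ioo] with x hx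
    rw [entryTrace, (hasSum_entryTrace hℓ0.le hℓ hΛ hf
      (by linarith [hx.1] : t - x ≤ n * ℓ - Λ) i).tsum_eq, Finset.sum_apply]
    symm
    refine Finset.sum_subset (fun m hm => Finset.mem_range.2 (Finset.mem_Ico.1 hm).2) ?_
    intro m hm hm'
    by_contra h
    have h2 := (mem_Ioo_of_iterate_vertexStep_ne_zero hℓ hΛ hf m h).2
    have h3 : m + 1 ≤ m₁ := by
      by_contra h4
      exact hm' (Finset.mem_Ico.2 ⟨by omega, Finset.mem_range.1 hm⟩)
    have h4 : ((m + 1 : ℕ) : ℝ) ≤ t / Λ :=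
      (Nat.cast_le.2 h3).trans (Nat.floor_le (by positivity))
    rw [le_div_iff₀ hΛ0] at h4
    push_cast at h4
    linarith [hx.2, hΛ i]
  have hterm : ∀ m, eLpNorm ((vertexStep L M E)^[m] f i ∘ fun x => t - x) p
      (volume.restrict (Ioo 0 (L i))) ≤ ENNReal.ofReal (B * ρ ^ m) * F := by
    intro m
    refine (eLpNorm_mono_measure _ Measure.restrict_le_self).trans ?_
    rw [eLpNorm_comp_measurePreserving
      (measurable_iterate_vertexStep hE hfm m i).aestronglyMeasurable
      (Measure.measurePreserving_sub_left volume t)]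
    refine (eLpNorm_iterate_vertexStep_le hp hE0 hΛ hf hfm (by positivity) (hH m) i).trans ?_
    exact mul_le_mul' (ENNReal.ofReal_le_ofReal (hB m)) le_rfl
  rw [eLpNorm_congr_ae h1]
  refine (eLpNorm_sum_le (fun m _ => ((measurable_iterate_vertexStep hE hfm m i).comp
    (measurable_const.sub measurable_id)).aestronglyMeasurable) hp).trans ?_
  refine (Finset.sum_le_sum fun m _ => hterm m).trans ?_
  rw [← Finset.sum_mul, ← ENNReal.ofReal_sum_of_nonneg (fun m _ => by positivity)]
  gcongr
  rw [← Finset.mul_sum]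
  have h3 := geom_sum_Ico_le_of_lt_one (m := m₁) (n := n) hρ0.le hρ1
  have h4 : ρ ^ m₁ ≤ ρ⁻¹ * Real.exp (-(-Real.log ρ / Λ) * t) := by
    have h5 : Real.exp (-(-Real.log ρ / Λ) * t) = ρ ^ (t / Λ) := by
      rw [Real.rpow_def_of_pos hρ0]
      congr 1
      field_simp
    rw [h5, ← Real.rpow_neg_one, ← Real.rpow_add hρ0, ← Real.rpow_natCast]
    refine Real.rpow_le_rpow_of_exponent_ge hρ0 hρ1.le ?_
    linarith [Nat.lt_floor_add_one (t / Λ)]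
  have h6 : 0 < 1 - ρ := by linarith
  calc B * ∑ m ∈ Finset.Ico m₁ n, ρ ^ m ≤ B * (ρ ^ m₁ / (1 - ρ)) := by gcongr
    _ ≤ B * (ρ⁻¹ * Real.exp (-(-Real.log ρ / Λ) * t) / (1 - ρ)) := by gcongr
    _ = B / (1 - ρ) * ρ⁻¹ * Real.exp (-(-Real.log ρ / Λ) * t) := by ring

end Trace

/-! ### The explicit flow is a mild solution -/

section Flow

/-- Damping coefficients `β i` acting on `[a i, b i]` from time zero on. -/
structure IsDamping {N : ℕ} (β : Fin N → ℝ → ℝ) (a b : Fin N → ℝ) : Prop where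
  measurable : ∀ i, Measurable (β i)
  mem_Icc : ∀ i s, β i s ∈ Icc (0 : ℝ) 1
  eq_zero : ∀ i, ∀ s ≤ 0, β i s = 0
  nonneg : ∀ i, 0 ≤ a i
  le : ∀ i, a i ≤ b i

/-- The balance law is solved here for the flux through `x`. In the coordinates `(τ, y)` the
coefficient along a characteristic is simply `β τ` on `[a, b]`, as in the damping operator. -/
lemma integral_damped_translate {β v : ℝ → ℝ} {a b t x : ℝ} (hβ : Measurable β)
    (hβ01 : ∀ s, β s ∈ Icc (0 : ℝ) 1) (ha : 0 ≤ a) (hab : a ≤ b)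
    (hvi : ∀ c d, IntegrableOn v (Ioc c d)) (ht : 0 ≤ t) (hx : 0 ≤ x) :
    ∫ τ in (0 : ℝ)..t, v (τ - x) * attenuation β a b (τ - x) x
      = (∫ s in (0 : ℝ)..t, v s) + (∫ y in (0 : ℝ)..x, v (0 - y) * attenuation β a b (0 - y) y)
        - (∫ y in (0 : ℝ)..x, v (t - y) * attenuation β a b (t - y) y)
        + ∫ y in (0 : ℝ)..x, ∫ τ in (0 : ℝ)..t,
          -((Icc a b).indicator (fun _ => β τ) y * (v (τ - y) * attenuation β a b (τ - y) y)) := by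
  have hk01 : ∀ s y, (Icc a b).indicator (fun y => β (s + y)) y ∈ Icc (0 : ℝ) 1 := fun s y => by
    by_cases h : y ∈ Icc a b
    · rw [indicator_of_mem h]; exact hβ01 _
    · rw [indicator_of_notMem h]; simp
  have hkm : Measurable (Function.uncurry fun s y => (Icc a b).indicator (fun y => β (s + y)) y) := by
    have : (Function.uncurry fun s y => (Icc a b).indicator (fun y => β (s + y)) y)
        = (Prod.snd ⁻¹' Icc a b).indicator fun z : ℝ × ℝ => β (z.1 + z.2) := rfl
    rw [this]
    exact (hβ.comp (by fun_prop)).indicator (measurable_snd measurableSet_Icc)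
  have key := integral_along_characteristics ht hx (hvi (-x) t) hkm
    (fun s y => abs_le.2 ⟨by linarith [(hk01 s y).1], (hk01 s y).2⟩)
    (G := attenuation β a b) (continuous_attenuation hβ hβ01).measurable
    (fun s y => by
      rw [abs_of_pos (attenuation_pos s y)]; exact attenuation_le_one hβ01 s y)
    (fun s y₁ y₂ h1 h2 => attenuation_sub hβ hβ01 ha s h1 h2)
  simp only [attenuation_zero_right ha hab, mul_one] at key
  have e : ∀ τ y, (Icc a b).indicator (fun y' => β (τ - y + y')) y
      = (Icc a b).indicator (fun _ => β τ) y := fun τ y => by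
    by_cases h : y ∈ Icc a b
    · rw [indicator_of_mem h, indicator_of_mem h, sub_add_cancel]
    · rw [indicator_of_notMem h, indicator_of_notMem h]
  simp only [e] at key
  simp only [intervalIntegral.integral_neg, zero_sub]
  linarith

/-- The components of the solution of the damped transport system with initial traces `f`. -/
def networkFlow {N : ℕ} (L : Fin N → ℝ) (M : Matrix (Fin N) (Fin N) ℝ) (β : Fin N → ℝ → ℝ)
    (a b : Fin N → ℝ) (f : Fin N → ℝ → ℝ) (i : Fin N) (t x : ℝ) : ℝ :=
  entryTrace L M (fun j s => attenuation (β j) (a j) (b j) s (L j)) f i (t - x)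
    * attenuation (β i) (a i) (b i) (t - x) x

variable {N Nd : ℕ} {L : Fin N → ℝ} {M : Matrix (Fin N) (Fin N) ℝ} {β : Fin N → ℝ → ℝ}
  {a b : Fin N → ℝ} {f : Fin N → ℝ → ℝ}

lemma IsDamping.measurable_attenuation (hβ : IsDamping β a b) (i : Fin N) (x : ℝ) :
    Measurable fun s => attenuation (β i) (a i) (b i) s x :=
  ((continuous_attenuation (hβ.measurable i) (hβ.mem_Icc i)).comp
    (continuous_id.prodMk continuous_const)).measurable

lemma measurable_networkFlow (hL : ∀ i, 0 < L i) (hβ : IsDamping β a b)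
    (hfm : ∀ i, Measurable (f i)) (hf : ∀ i s, f i s ≠ 0 → s ∈ Ioo (-L i) 0) (i : Fin N) :
    Measurable (Function.uncurry (networkFlow L M β a b f i)) := by
  have h1 := measurable_entryTrace (M := M) hL (fun j => hβ.measurable_attenuation j (L j)) hfm hf i
  have h2 : Measurable fun z : ℝ × ℝ => attenuation (β i) (a i) (b i) (z.1 - z.2) z.2 :=
    ((continuous_attenuation (hβ.measurable i) (hβ.mem_Icc i)).comp (f := fun z : ℝ × ℝ =>
      (z.1 - z.2, z.2)) (by fun_prop)).measurable
  exact (h1.comp (measurable_fst.sub measurable_snd)).mul h2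

lemma networkFlow_zero_left (hL : ∀ i, 0 < L i) (hβ : IsDamping β a b)
    (hf : ∀ i s, f i s ≠ 0 → s ∈ Ioo (-L i) 0) (i : Fin N) {x : ℝ} (hx : 0 ≤ x) :
    networkFlow L M β a b f i 0 x = f i (-x) := by
  rw [networkFlow, zero_sub, entryTrace_of_nonpos hL hf i (by linarith)]
  have := attenuation_neg_right (a := a i) (b := b i) (hβ.eq_zero i) (-x)
  rw [neg_neg] at this
  rw [this, mul_one]

lemma abs_networkFlow_le (hβ : IsDamping β a b) (i : Fin N) (t x : ℝ) :
    |networkFlow L M β a b f i t x|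
      ≤ |entryTrace L M (fun j s => attenuation (β j) (a j) (b j) s (L j)) f i (t - x)| := by
  rw [networkFlow, abs_mul, abs_of_pos (attenuation_pos _ _)]
  exact mul_le_of_le_one_right (abs_nonneg _) (attenuation_le_one (hβ.mem_Icc i) _ _)

lemma memLp_networkFlow (hL : ∀ i, 0 < L i) (hβ : IsDamping β a b) {p : ℝ≥0∞}
    (hfm : ∀ i, Measurable (f i)) (hf : ∀ i s, f i s ≠ 0 → s ∈ Ioo (-L i) 0)
    (hfp : ∀ i, MemLp (f i) p volume) (i : Fin N) (t : ℝ) :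
    MemLp (networkFlow L M β a b f i t) p (volume.restrict (Ioo 0 (L i))) := by
  have h1 := memLp_indicator_entryTrace (M := M) hL (fun j => hβ.measurable_attenuation j (L j))
    (fun j s => (attenuation_pos s (L j)).le) (fun j s => attenuation_le_one (hβ.mem_Icc j) s (L j))
    hfp hf i (t + 1)
  have h2 := (h1.comp_measurePreserving (Measure.measurePreserving_sub_left volume t)).restrict
    (Ioo 0 (L i))
  refine h2.mono ((measurable_networkFlow hL hβ hfm hf i).comp
    (measurable_const.prodMk measurable_id)).aestronglyMeasurable ?_
  filter_upwards [ae_restrict_mem measurableSet_Ioo] with x hx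
  have : t - x ∈ Iio (t + 1) := by simp only [mem_Iio]; linarith [hx.1]
  rw [Function.comp_apply, indicator_of_mem this]
  exact abs_networkFlow_le hβ i t x

lemma integrableOn_entryTrace (hL : ∀ i, 0 < L i) (hβ : IsDamping β a b) {p : ℝ≥0∞} (hp : 1 ≤ p)
    (hf : ∀ i s, f i s ≠ 0 → s ∈ Ioo (-L i) 0)
    (hfp : ∀ i, MemLp (f i) p volume) (i : Fin N) (c d : ℝ) :
    IntegrableOn (entryTrace L M (fun j s => attenuation (β j) (a j) (b j) s (L j)) f i)
      (Ioc c d) := by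
  have h1 := memLp_indicator_entryTrace (M := M) hL (fun j => hβ.measurable_attenuation j (L j))
    (fun j s => (attenuation_pos s (L j)).le) (fun j s => attenuation_le_one (hβ.mem_Icc j) s (L j))
    hfp hf i (d + 1)
  refine ((h1.restrict (Ioc c d)).integrable hp).congr ?_
  filter_upwards [ae_restrict_mem measurableSet_Ioc] with s hs
  exact indicator_of_mem (by simp only [mem_Iio]; linarith [hs.2]) _

/-- The flow satisfies the transmission condition. -/
lemma integral_networkFlow_zero_right (hL : ∀ i, 0 < L i) (hβ : IsDamping β a b) {p : ℝ≥0∞}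
    (hp : 1 ≤ p) (hf : ∀ i s, f i s ≠ 0 → s ∈ Ioo (-L i) 0)
    (hfp : ∀ i, MemLp (f i) p volume) (i : Fin N) {t : ℝ} (ht : 0 ≤ t) :
    ∫ τ in (0 : ℝ)..t, networkFlow L M β a b f i τ 0
      = ∑ j, M i j * ∫ τ in (0 : ℝ)..t, networkFlow L M β a b f j τ (L j) := by
  have hint : ∀ j, IntervalIntegrable (fun τ => networkFlow L M β a b f j τ (L j)) volume 0 t := by
    intro j
    have h1 := integrableOn_entryTrace (M := M) hL hβ hp hf hfp j (0 - L j) (t - L j)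
    have h2 : IntervalIntegrable (fun s =>
        entryTrace L M (fun j s => attenuation (β j) (a j) (b j) s (L j)) f j s
          * attenuation (β j) (a j) (b j) s (L j)) volume (0 - L j) (t - L j) := by
      rw [intervalIntegrable_iff_integrableOn_Ioc_of_le (by linarith)]
      refine Integrable.mono h1 (h1.aestronglyMeasurable.mul
        (hβ.measurable_attenuation j (L j)).aestronglyMeasurable)
        (Filter.Eventually.of_forall fun s => ?_)
      rw [norm_mul, Real.norm_eq_abs (attenuation _ _ _ _ _), abs_of_pos (attenuation_pos _ _)]
      exact mul_le_of_le_one_right (norm_nonneg _) (attenuation_le_one (hβ.mem_Icc j) _ _)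
    have h3 := h2.comp_sub_right (L j)
    simp only [sub_add_cancel] at h3
    exact h3
  simp only [← intervalIntegral.integral_const_mul]
  rw [← intervalIntegral.integral_finsetSum fun j _ => (hint j).const_mul (M i j)]
  refine intervalIntegral.integral_congr fun τ hτ => ?_
  rw [uIcc_of_le ht] at hτ
  simp only [networkFlow]
  rw [attenuation_zero_right (hβ.nonneg i) (hβ.le i), mul_one, sub_zero,
    entryTrace_of_pos hL hf i hτ.1]
  refine Finset.sum_congr rfl fun j _ => ?_
  ring

/-- Integration in time regularizes: a single time slice of the flow is only in `Lᵖ`, but by the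
balance law the flux through `x` over `[0, t]` is a primitive in `x`. -/
lemma isSobolevRepr_integral_networkFlow (hL : ∀ i, 0 < L i) (hβ : IsDamping β a b) {p : ℝ≥0∞}
    [Fact (1 ≤ p)] (hf : ∀ i s, f i s ≠ 0 → s ∈ Ioo (-L i) 0)
    (hfp : ∀ i, MemLp (f i) p volume) (i : Fin N) {t : ℝ} (ht : 0 ≤ t)
    {U Zt Z0 D : Lp ℝ p (volume.restrict (Ioo 0 (L i)))}
    (hU : U =ᵐ[volume.restrict (Ioo 0 (L i))]
      fun x => ∫ τ in (0 : ℝ)..t, networkFlow L M β a b f i τ x)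
    (hZt : Zt =ᵐ[volume.restrict (Ioo 0 (L i))] networkFlow L M β a b f i t)
    (hZ0 : Z0 =ᵐ[volume.restrict (Ioo 0 (L i))] networkFlow L M β a b f i 0)
    (hD : D =ᵐ[volume.restrict (Ioo 0 (L i))] fun x => ∫ τ in (0 : ℝ)..t,
      -((Icc (a i) (b i)).indicator (fun _ => β i τ) x * networkFlow L M β a b f i τ x)) :
    IsSobolevRepr U (-(Zt - Z0 - D)) fun x => ∫ τ in (0 : ℝ)..t, networkFlow L M β a b f i τ x := by
  refine ⟨fun x hx => ?_, hU⟩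
  have hs : uIcc 0 x ⊆ uIcc 0 (L i) := by
    rw [uIcc_of_le hx.1, uIcc_of_le (hL i).le]; exact Icc_subset_Icc le_rfl hx.2
  have hint : ∀ W : Lp ℝ p (volume.restrict (Ioo 0 (L i))), IntervalIntegrable W volume 0 x :=
    fun W => (intervalIntegrable_coeFn_Lp (hL i).le W).mono_set hs
  have hcongr : ∀ {φ ψ : ℝ → ℝ}, φ =ᵐ[volume.restrict (Ioo 0 (L i))] ψ →
      ∫ s in (0 : ℝ)..x, φ s = ∫ s in (0 : ℝ)..x, ψ s := by
    intro φ ψ h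
    rw [intervalIntegral.integral_of_le hx.1, intervalIntegral.integral_of_le hx.1,
      integral_Ioc_eq_integral_Ioo, integral_Ioc_eq_integral_Ioo]
    exact integral_congr_ae (ae_restrict_of_ae_restrict_of_subset (Ioo_subset_Ioo le_rfl hx.2) h)
  have hW : ∫ s in (0 : ℝ)..x, (-(Zt - Z0 - D) : Lp ℝ p (volume.restrict (Ioo 0 (L i)))) s
      = -((∫ s in (0 : ℝ)..x, Zt s) - (∫ s in (0 : ℝ)..x, Z0 s) - ∫ s in (0 : ℝ)..x, D s) := by
    rw [← intervalIntegral.integral_sub (hint Zt) (hint Z0),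
      ← intervalIntegral.integral_sub ((hint Zt).sub (hint Z0)) (hint D),
      ← intervalIntegral.integral_neg]
    refine hcongr ?_
    filter_upwards [Lp.coeFn_neg (Zt - Z0 - D), Lp.coeFn_sub (Zt - Z0) D,
      Lp.coeFn_sub Zt Z0] with s h1 h2 h3
    rw [h1, Pi.neg_apply, h2, Pi.sub_apply, h3, Pi.sub_apply]
  rw [hW, hcongr hZt, hcongr hZ0, hcongr hD]
  have hbal := integral_damped_translate (hβ.measurable i) (hβ.mem_Icc i) (hβ.nonneg i) (hβ.le i)
    (integrableOn_entryTrace (M := M) hL hβ Fact.out hf hfp i) ht hx.1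
  have h0 : ∫ τ in (0 : ℝ)..t, networkFlow L M β a b f i τ 0 = ∫ s in (0 : ℝ)..t,
      entryTrace L M (fun j s => attenuation (β j) (a j) (b j) s (L j)) f i s := by
    simp only [networkFlow, attenuation_zero_right (hβ.nonneg i) (hβ.le i), mul_one, sub_zero]
  simp only [h0]
  simp only [networkFlow]
  rw [hbal]
  ring

variable {hNd : Nd ≤ N} {a' b' : Fin Nd → ℝ} {α : Fin Nd → ℝ → ℝ}

/-- A function with values in `∏ᵢ Lᵖ(0, Lᵢ)` that is pointwise given by `networkFlow` is a mild
solution. -/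
lemma isMildSolution_of_coeFn_eq_networkFlow (hL : ∀ i, 0 < L i) (hβ : IsDamping β a b)
    (ha : ∀ k, a (Fin.castLE hNd k) = a' k) (hb : ∀ k, b (Fin.castLE hNd k) = b' k)
    (hα : ∀ k, AEMeasurable (α k)) (hα1 : ∀ k, ∀ᵐ s, α k s ∈ Icc (0 : ℝ) 1)
    (hβα : ∀ k, ∀ᵐ τ, 0 < τ → β (Fin.castLE hNd k) τ = α k τ)
    (hβ0 : ∀ i, (∀ k, Fin.castLE hNd k ≠ i) → β i = 0)
    {p : ℝ≥0∞} [Fact (1 ≤ p)] (hp : p ≠ ∞)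
    (hfm : ∀ i, Measurable (f i)) (hf : ∀ i s, f i s ≠ 0 → s ∈ Ioo (-L i) 0)
    (hfp : ∀ i, MemLp (f i) p volume) {z₀ : NetworkSpace L p} {z : ℝ → NetworkSpace L p}
    (hz : ∀ t i, z t i =ᵐ[volume.restrict (Ioo 0 (L i))] networkFlow L M β a b f i t)
    (hz₀ : ∀ i, z₀ i =ᵐ[volume.restrict (Ioo 0 (L i))] fun x => f i (-x)) :
    IsMildSolution hNd L M a' b' α p z₀ z := by
  have hz0 : z 0 = z₀ := by
    funext i
    refine Lp.ext ((hz 0 i).trans (Filter.EventuallyEq.trans ?_ (hz₀ i).symm))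
    filter_upwards [ae_restrict_mem measurableSet_Ioo] with x hx
    exact networkFlow_zero_left hL hβ hf i hx.1.le
  have hzc : Continuous z := by
    refine continuous_pi fun i => ?_
    refine continuous_of_coeFn_eq_translate hp (v := entryTrace L M
      (fun j s => attenuation (β j) (a j) (b j) s (L j)) f i)
      (G := fun t x => attenuation (β i) (a i) (b i) (t - x) x) (κ := 2)
      (memLp_indicator_entryTrace hL (fun j => hβ.measurable_attenuation j (L j))
        (fun j s => (attenuation_pos s (L j)).le)
        (fun j s => attenuation_le_one (hβ.mem_Icc j) s (L j)) hfp hf i)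
      (fun t x => ?_) (fun t t' x => ?_) (fun t => hz t i)
    · rw [abs_of_pos (attenuation_pos _ _)]
      exact attenuation_le_one (hβ.mem_Icc i) _ _
    · refine (abs_attenuation_sub_le (hβ.measurable i) (hβ.mem_Icc i) _ _ _).trans (le_of_eq ?_)
      rw [sub_sub_sub_cancel_right]
  refine ⟨hzc.continuousOn, hz0, fun t ht => ?_⟩
  have hzi : IntervalIntegrable z volume 0 t := hzc.intervalIntegrable 0 t
  have hdi := intervalIntegrable_damping hNd L a' b' hα hα1 hzc.continuousOn le_rfl ht
  have hproj : ∀ {w : ℝ → NetworkSpace L p}, IntervalIntegrable w volume 0 t → ∀ i,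
      (∫ τ in (0 : ℝ)..t, w τ) i = ∫ τ in (0 : ℝ)..t, w τ i := fun hw i =>
    (ContinuousLinearMap.intervalIntegral_comp_comm (ContinuousLinearMap.proj (R := ℝ)
      (φ := fun i => Lp ℝ p (volume.restrict (Ioo 0 (L i)))) i) hw).symm
  have hproji : ∀ {w : ℝ → NetworkSpace L p}, IntervalIntegrable w volume 0 t → ∀ i,
      IntervalIntegrable (fun τ => w τ i) volume 0 t := fun hw i => by
    rw [intervalIntegrable_iff] at hw ⊢
    exact (ContinuousLinearMap.proj (R := ℝ)
      (φ := fun i => Lp ℝ p (volume.restrict (Ioo 0 (L i)))) i).integrable_comp hw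
  have hdamp : ∀ i, ∀ᵐ τ ∂(volume.restrict (Ioc 0 t)),
      (∑ k, α k τ • dampingOp hNd L a' b' k (z τ)) i =ᵐ[volume.restrict (Ioo 0 (L i))]
        fun x => -((Icc (a i) (b i)).indicator (fun _ => β i τ) x
          * networkFlow L M β a b f i τ x) := by
    intro i
    filter_upwards [ae_restrict_of_ae (ae_all_iff.2 hβα), ae_restrict_mem measurableSet_Ioc]
      with τ hτ hτt
    rw [Finset.sum_apply]
    by_cases h : ∃ k, Fin.castLE hNd k = i
    · obtain ⟨k, rfl⟩ := h
      rw [Finset.sum_eq_single k (fun k' _ hk' => by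
        rw [Pi.smul_apply, dampingOp, Pi.single_eq_of_ne
          (fun h => hk' ((Fin.castLE_injective hNd h).symm)), smul_zero]) (by simp),
        Pi.smul_apply, dampingOp, Pi.single_eq_same]
      filter_upwards [Lp.coeFn_smul (α k τ) (-mulCharFun (a' k) (b' k) (z τ (Fin.castLE hNd k))),
        Lp.coeFn_neg (mulCharFun (a' k) (b' k) (z τ (Fin.castLE hNd k))),
        coeFn_mulCharFun (a' k) (b' k) (z τ (Fin.castLE hNd k)), hz τ (Fin.castLE hNd k)]
        with x h1 h2 h3 h4
      rw [h1, Pi.smul_apply, h2, Pi.neg_apply, h3, ha, hb, smul_eq_mul]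
      by_cases hx : x ∈ Icc (a' k) (b' k)
      · rw [indicator_of_mem hx, indicator_of_mem hx, h4, hτ k hτt.1, mul_neg]
      · rw [indicator_of_notMem hx, indicator_of_notMem hx, neg_zero, mul_zero, zero_mul, neg_zero]
    · push Not at h
      rw [Finset.sum_eq_zero fun k _ => by
        rw [Pi.smul_apply, dampingOp, Pi.single_eq_of_ne (h k).symm, smul_zero]]
      filter_upwards [Lp.coeFn_zero ℝ p (volume.restrict (Ioo 0 (L i)))] with x hx
      rw [hx, hβ0 i h]
      simp
  have hflow := fun i => measurable_networkFlow (M := M) hL hβ hfm hf i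
  -- The pointwise integrals are defined at every `x`, so they also provide the traces at both ends
  -- of the edge.
  refine ⟨fun i x => ∫ τ in (0 : ℝ)..t, networkFlow L M β a b f i τ x, fun i => ?_, fun i =>
    integral_networkFlow_zero_right hL hβ Fact.out hf hfp i ht⟩
  refine isSobolevRepr_integral_networkFlow hL hβ hf hfp i ht ?_ (hz t i)
    (by rw [← hz0]; exact hz 0 i) ?_
  · rw [hproj hzi]
    exact coeFn_intervalIntegral_Lp ht (hproji hzi i) (hflow i)
      (Filter.Eventually.of_forall fun τ => hz τ i)
  · rw [hproj hdi]
    refine coeFn_intervalIntegral_Lp ht (hproji hdi i) (g := fun τ x =>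
      -((Icc (a i) (b i)).indicator (fun _ => β i τ) x * networkFlow L M β a b f i τ x)) ?_ (hdamp i)
    have h1 : Measurable fun z : ℝ × ℝ => (Icc (a i) (b i)).indicator (fun _ => β i z.1) z.2 := by
      have : (fun z : ℝ × ℝ => (Icc (a i) (b i)).indicator (fun _ => β i z.1) z.2)
        = (Prod.snd ⁻¹' Icc (a i) (b i)).indicator fun z : ℝ × ℝ => β i z.1 := rfl
      rw [this]
      exact ((hβ.measurable i).comp measurable_fst).indicator (measurable_snd measurableSet_Icc)
    exact (h1.mul (hflow i)).neg

end Flow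

/-! ### Excitation of a damped edge and preparation of the data -/

/-- A signal with values in `[0, 1]` has a Borel representative on `(0, ∞)` that vanishes on
`(-∞, 0]`. -/
lemma exists_measurable_cutoff {α : ℝ → ℝ} (hα : AEMeasurable α)
    (hα1 : ∀ᵐ s, α s ∈ Icc (0 : ℝ) 1) :
    ∃ β : ℝ → ℝ, Measurable β ∧ (∀ s, β s ∈ Icc (0 : ℝ) 1) ∧ (∀ s ≤ 0, β s = 0) ∧
      ∀ᵐ s, 0 < s → β s = α s := by
  refine ⟨(Ioi 0).indicator fun s => max 0 (min 1 (hα.mk α s)),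
    (measurable_const.max (measurable_const.min hα.measurable_mk)).indicator measurableSet_Ioi,
    fun s => ?_, fun s hs => indicator_of_notMem (notMem_Ioi.2 hs) _, ?_⟩
  · by_cases h : s ∈ Ioi 0
    · rw [indicator_of_mem h]
      exact ⟨le_max_left _ _, max_le zero_le_one (min_le_left _ _)⟩
    · rw [indicator_of_notMem h]; simp
  · filter_upwards [hα1, hα.ae_eq_mk] with s h1 h2 hs
    rw [indicator_of_mem (mem_Ioi.2 hs), ← h2, min_eq_right h1.2, max_eq_right h1.1]

/-- A persistently exciting damping on `[a, b]` damps all particles that enter the edge during some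
time interval of length `(b - a) / 2` in every long enough time window. -/
lemma exists_window_attenuation_le {β : ℝ → ℝ} (hβ : Measurable β)
    (hβ01 : ∀ s, β s ∈ Icc (0 : ℝ) 1) {a b ℓ T μ : ℝ} (ha : 0 ≤ a) (hab : a < b) (hb : b ≤ ℓ)
    (hT : 0 < T) (hPE : ∀ t, 0 ≤ t → μ ≤ ∫ s in t..(t + T), β s) {t : ℝ} (ht : 0 ≤ t) :
    ∃ τ ∈ Icc t (t + (T + (b - a) / 2)), ∀ s ∈ Icc τ (τ + (b - a) / 2),
      attenuation β a b s ℓ ≤ Real.exp (-(μ / ⌈T / ((b - a) / 2)⌉₊)) := by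
  set w := (b - a) / 2 with hw
  have hw0 : 0 < w := by linarith
  obtain ⟨σ, hσ, hint⟩ := exists_short_interval_integral_ge hw0 hT
    (locallyIntegrable_of_mem_Icc hβ hβ01) (fun s => (hβ01 s).1)
    (hPE (t + w + a) (by linarith))
  -- A particle entering at time `s` is in the damped region during `[s + a, s + b]`, of length `2
  -- w`. This contains `[σ, σ + w]` exactly if `s` lies in an interval of length `w` starting at `σ
  -- - w - a`.
  refine ⟨σ - w - a, ⟨by linarith [hσ.1], by linarith [hσ.2]⟩, fun s hs => ?_⟩
  rw [attenuation, Real.exp_le_exp, neg_le_neg_iff, dampingExponent, min_eq_right hb,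
    max_eq_right hab.le]
  exact hint.trans (intervalIntegral.integral_mono_interval (by linarith [hs.2]) (by linarith)
    (by linarith [hs.1]) (Filter.Eventually.of_forall fun r => (hβ01 r).1)
    (intervalIntegrable_of_mem_Icc hβ hβ01 _ _))

/-- The signals and damping intervals of the damped edges, extended by zero to all edges. -/
lemma exists_isDamping {N Nd : ℕ} (hNd : Nd ≤ N) {a b : Fin Nd → ℝ} (ha : ∀ k, 0 ≤ a k)
    (hab : ∀ k, a k ≤ b k) {α : Fin Nd → ℝ → ℝ} (hα : ∀ k, AEMeasurable (α k))
    (hα1 : ∀ k, ∀ᵐ s, α k s ∈ Icc (0 : ℝ) 1) :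
    ∃ (β : Fin N → ℝ → ℝ) (a' b' : Fin N → ℝ), IsDamping β a' b' ∧
      (∀ k, a' (Fin.castLE hNd k) = a k) ∧ (∀ k, b' (Fin.castLE hNd k) = b k) ∧
      (∀ k, ∀ᵐ τ, 0 < τ → β (Fin.castLE hNd k) τ = α k τ) ∧
      ∀ i, (∀ k, Fin.castLE hNd k ≠ i) → β i = 0 := by
  choose β hβm hβ1 hβ0 hβα using fun k => exists_measurable_cutoff (hα k) (hα1 k)
  have hinj := Fin.castLE_injective hNd
  refine ⟨Function.extend (Fin.castLE hNd) β 0, Function.extend (Fin.castLE hNd) a 0,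
    Function.extend (Fin.castLE hNd) b 0, ⟨?_, ?_, ?_, ?_, ?_⟩, hinj.extend_apply _ _,
    hinj.extend_apply _ _, fun k => by rw [hinj.extend_apply]; exact hβα k, fun i hi =>
    Function.extend_apply' _ _ _ fun ⟨k, hk⟩ => hi k hk⟩
  all_goals
    intro i
    by_cases h : ∃ k, Fin.castLE hNd k = i
    · obtain ⟨k, rfl⟩ := h
      simp only [hinj.extend_apply]
      first
      | exact hβm k
      | exact hβ1 k
      | exact hβ0 k
      | exact ha k
      | exact hab k
    · simp only [Function.extend_apply' _ _ _ h]
      first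
      | exact measurable_const
      | simp

/-- The function `s ↦ u (-s)` on `(-ℓ, 0)`, extended by zero. -/
def reflectedExtension {ℓ : ℝ} {p : ℝ≥0∞} (u : Lp ℝ p (volume.restrict (Ioo 0 ℓ))) (s : ℝ) : ℝ :=
  (Ioo 0 ℓ).indicator u (-s)

lemma measurable_reflectedExtension {ℓ : ℝ} {p : ℝ≥0∞}
    (u : Lp ℝ p (volume.restrict (Ioo 0 ℓ))) : Measurable (reflectedExtension u) :=
  ((Lp.stronglyMeasurable u).measurable.indicator measurableSet_Ioo).comp measurable_neg

lemma memLp_reflectedExtension {ℓ : ℝ} {p q : ℝ≥0∞} (hqp : q ≤ p)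
    (u : Lp ℝ p (volume.restrict (Ioo 0 ℓ))) : MemLp (reflectedExtension u) q volume := by
  have h1 : MemLp u q (volume.restrict (Ioo 0 ℓ)) := (Lp.memLp u).mono_exponent hqp
  have h2 : MemLp ((Ioo 0 ℓ).indicator u) q volume :=
    (memLp_indicator_iff_restrict measurableSet_Ioo).2 h1
  exact h2.comp_measurePreserving (f := fun s : ℝ => -s) (Measure.measurePreserving_neg volume)

lemma eLpNorm_reflectedExtension {ℓ : ℝ} {p : ℝ≥0∞} (u : Lp ℝ p (volume.restrict (Ioo 0 ℓ))) :
    eLpNorm (reflectedExtension u) p volume = eLpNorm u p (volume.restrict (Ioo 0 ℓ)) := by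
  rw [← eLpNorm_indicator_eq_eLpNorm_restrict measurableSet_Ioo]
  exact eLpNorm_comp_measurePreserving (f := fun s : ℝ => -s)
    ((Lp.stronglyMeasurable u).measurable.indicator measurableSet_Ioo).aestronglyMeasurable
    (Measure.measurePreserving_neg volume)

end

/-! ### The main theorem -/

theorem theorem1p2 (N Nd : ℕ) (hN : 2 ≤ N) (hNd1 : 1 ≤ Nd) (hNd : Nd ≤ N)
    (L : Fin N → ℝ) (hL : ∀ i, 0 < L i)
    (a b : Fin Nd → ℝ)
    (hab : ∀ k, 0 ≤ a k ∧ a k < b k ∧ b k ≤ L (Fin.castLE hNd k))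
    (M : Matrix (Fin N) (Fin N) ℝ) (hM1 : matrixL1Norm M ≤ 1) (hM : ∀ i j, M i j ≠ 0)
    (hirr : ∃ i j, Irrational (L i / L j)) :
    ∀ T μ : ℝ, 0 < μ → μ ≤ T →
      ∃ C γ : ℝ, 0 < C ∧ 0 < γ ∧
        ∀ (p : ℝ≥0∞) [Fact (1 ≤ p)] (z₀ : NetworkSpace L p) (α : Fin Nd → ℝ → ℝ),
          (∀ k, IsPersistentlyExciting T μ (α k)) →
            ∃ z : ℝ → NetworkSpace L p,
              IsTransportSolution hNd L M a b α p z₀ z ∧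
              (∀ z' : ℝ → NetworkSpace L p, IsTransportSolution hNd L M a b α p z₀ z' →
                ∀ t : ℝ, 0 ≤ t → z' t = z t) ∧
              ∀ t : ℝ, 0 ≤ t →
                ∑ i, ‖z t i‖ ≤ C * Real.exp (-γ * t) * ∑ i, ‖z₀ i‖ := by
  intro T μ hμ hμT
  have hN0 : 0 < N := by omega
  have hT : 0 < T := hμ.trans_le hμT
  have hcol : ∀ j, ∑ i, |M i j| ≤ 1 := fun j => (sum_abs_le_matrixL1Norm M j).trans hM1
  obtain ⟨-, Λ, -, hΛ0, -, hΛ⟩ := exists_edge_length_bounds hL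
  -- A single damped edge produces the decay; the others only have to be nonexpansive.
  set k₀ : Fin Nd := ⟨0, hNd1⟩
  set w := (b k₀ - a k₀) / 2 with hw
  have hw0 : 0 < w := by linarith [(hab k₀).2.1]
  set ν := μ / ⌈T / w⌉₊
  have hν : 0 < ν := div_pos hμ (by exact_mod_cast Nat.ceil_pos.2 (by positivity))
  -- The loss is `δ = 1 - exp (-ν)`. All constants are fixed here, before `p`, the data and the
  -- signals.
  obtain ⟨C₀, η, hC₀, hη0, hη1, hsurv⟩ := exists_survival_le_geometric hL hcol hM hirr
    (Fin.castLE hNd k₀) Λ (T + w) hw0 (sub_pos.2 (Real.exp_lt_one_iff.2 (neg_neg_of_pos hν)))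
  obtain ⟨C, γ, hC, hγ, hdecay⟩ := exists_eLpNorm_entryTrace_le hL hΛ0 hΛ M hC₀ hη0 hη1
  refine ⟨N * C, γ, by positivity, hγ, ?_⟩
  intro p hp z₀ α hα
  have hαm : ∀ k, AEMeasurable (α k) := fun k => (hα k).1
  have hα1 : ∀ k, ∀ᵐ s, α k s ∈ Icc (0 : ℝ) 1 := fun k => (hα k).2.1
  obtain ⟨β, a', b', hβ, ha', hb', hβα, hβ0⟩ := exists_isDamping hNd (fun k => (hab k).1)
    (fun k => (hab k).2.1.le) hαm hα1
  set f : Fin N → ℝ → ℝ := fun j => reflectedExtension (z₀ j) with hfdef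
  have hfm : ∀ j, Measurable (f j) := fun j => measurable_reflectedExtension (z₀ j)
  have hf : ∀ i s, f i s ≠ 0 → s ∈ Ioo (-L i) 0 := by
    intro i s h
    have := mem_of_indicator_ne_zero h
    exact ⟨by linarith [this.2], by linarith [this.1]⟩
  have hfq : ∀ {q : ℝ≥0∞}, q ≤ p → ∀ j, MemLp (f j) q volume := fun hq j =>
    memLp_reflectedExtension hq (z₀ j)
  have hf0 : ∀ j, z₀ j =ᵐ[volume.restrict (Ioo 0 (L j))] fun x => f j (-x) := fun j => by
    filter_upwards [ae_restrict_mem measurableSet_Ioo] with x hx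
    simp only [hfdef, reflectedExtension, neg_neg, indicator_of_mem hx]
  set z : ℝ → NetworkSpace L p := fun t i =>
    (memLp_networkFlow (M := M) hL hβ hfm hf (hfq le_rfl) i t).toLp _ with hzdef
  have hz : ∀ t i, z t i =ᵐ[volume.restrict (Ioo 0 (L i))] networkFlow L M β a' b' f i t :=
    fun t i => MemLp.coeFn_toLp _
  -- One pointwise formula represents `z` for all exponents at once, which settles `p = ∞` by
  -- working in each finite `q`.
  have hsol : IsTransportSolution hNd L M a b α p z₀ z := by
    refine ⟨fun hp' => isMildSolution_of_coeFn_eq_networkFlow hL hβ ha' hb' hαm hα1 hβα hβ0 hp' hfm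
      hf (hfq le_rfl) hz hf0, fun _ q _ hqp hq => ?_⟩
    exact isMildSolution_of_coeFn_eq_networkFlow hL hβ ha' hb' hαm hα1 hβα hβ0 hq hfm hf (hfq hqp)
      (fun t i => (MemLp.coeFn_toLp _).trans (hz t i)) fun i => (MemLp.coeFn_toLp _).trans (hf0 i)
  refine ⟨z, hsol, fun z' hz' t ht => hz'.eq hNd hN0 hNd1 hL hcol hαm hα1 hsol ht, fun t ht => ?_⟩
  have hPE : ∀ t, 0 ≤ t → μ ≤ ∫ s in t..(t + T), β (Fin.castLE hNd k₀) s := by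
    intro t ht
    refine ((hα k₀).2.2 t).trans (le_of_eq (intervalIntegral.integral_congr_ae ?_))
    filter_upwards [hβα k₀] with s hs hst
    rw [uIoc_of_le (by linarith)] at hst
    exact (hs (ht.trans_lt hst.1)).symm
  have hH := hsurv (fun j s => attenuation (β j) (a' j) (b' j) s (L j))
    (fun j s => (attenuation_pos s (L j)).le) (fun j s => attenuation_le_one (hβ.mem_Icc j) s (L j))
    (fun t ht => by
      have := exists_window_attenuation_le (hβ.measurable (Fin.castLE hNd k₀))
        (hβ.mem_Icc (Fin.castLE hNd k₀)) (hab k₀).1 (hab k₀).2.1 (hab k₀).2.2 hT hPE ht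
      rwa [sub_sub_cancel, ha', hb'])
  have hbound : ∀ i, ‖z t i‖ ≤ C * Real.exp (-γ * t) * ∑ j, ‖z₀ j‖ := by
    intro i
    have h1 := hdecay (fun j s => attenuation (β j) (a' j) (b' j) s (L j)) f p Fact.out
      (fun j => hβ.measurable_attenuation j (L j)) (fun j s => (attenuation_pos s (L j)).le) hH hfm
      hf t ht i
    have h2 := (eLpNorm_mono (p := p) (μ := volume.restrict (Ioo 0 (L i)))
      (f := networkFlow L M β a' b' f i t) fun x => by
        simpa only [Real.norm_eq_abs] using abs_networkFlow_le hβ i t x).trans h1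
    simp only [hfdef, eLpNorm_reflectedExtension] at h2
    have hfin : ∀ j ∈ Finset.univ, eLpNorm (z₀ j) p (volume.restrict (Ioo 0 (L j))) ≠ ∞ :=
      fun j _ => Lp.eLpNorm_ne_top (z₀ j)
    have h3 := ENNReal.toReal_mono
      (ENNReal.mul_ne_top ENNReal.ofReal_ne_top (ENNReal.sum_ne_top.2 hfin)) h2
    rw [ENNReal.toReal_mul, ENNReal.toReal_ofReal (by positivity), ENNReal.toReal_sum hfin] at h3
    rw [hzdef, Lp.norm_toLp]
    exact h3
  calc ∑ i, ‖z t i‖ ≤ ∑ _i : Fin N, C * Real.exp (-γ * t) * ∑ j, ‖z₀ j‖ :=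
        Finset.sum_le_sum fun i _ => hbound i
    _ = N * C * Real.exp (-γ * t) * ∑ i, ‖z₀ i‖ := by
        rw [Finset.sum_const, Finset.card_univ, Fintype.card_fin, nsmul_eq_mul]
        ring
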